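/- A \emph{partial ring} is a set $A$ with elements $0,1$, a subset $A_2\subseteq A\times A$ of summable pairs, a map $+\colon A_2\to A$, and a commutative, associative multiplication with unit $1$, such that for all $a,b,c,x\in A$: $(0,a),(a,0)\in A_2$ and $0+a=a=a+0$; if $(a,b)\in A_2$ then $(b,a)\in A_2$ and $a+b=b+a$; one has $(a,b),(a+b,c)\in A_2$ if and only if $(b,c),(a,b+c)\in A_2$, and then $(a+b)+c=a+(b+c)$; $0\cdot a=0$; and if $(a,b)\in A_2$ then $(ax,bx)\in A_2$ and $ax+bx=(a+b)x$. A homomorphism preserves $0$, $1$, products, summability of pairs, and sums. An \emph{ideal} is a subset $I\ni 0$ with $AI\subseteq I$ and $a+b\in I$ whenever $a,b\in I$, $(a,b)\in A_2$. It is \emph{prime} if $I\ne A$ and $ab\in I$ implies $a\in I$ or $b\in I$. A partial ring is \emph{local} if it has exactly one maximal ideal (among ideals $\neq A$); a homomorphism of local partial rings is required to pull back the maximal ideal to the maximal ideal. A \emph{locally partial-ringed space} is a topological space with a sheaf of partial rings all of whose stalks are local. A morphism $(X,\mathcal O_X)\to(Y,\mathcal O_Y)$ is a continuous map $f\colon X\to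 Y$ with a homomorphism $\mathcal O_Y\to f_*\mathcal O_X$ of sheaves of partial rings inducing homomorphisms of local partial rings on all stalks. For a multiplicative subset $S\subseteq A$, the partial ring $S^{-1}A$ consists of the fractions $a/s$, where $a/s=b/t$ iff $uta=usb$ for some $u\in S$; the pair $(a/s,b/t)$ is summable iff $(uta,usb)\in A_2$ for some $u\in S$, and then $a/s+b/t=(uta+usb)/(ust)$; and $(a/s)(b/t)=ab/(st)$. The locally partial-ringed space $\operatorname{Spec}A$ is the set $X$ of prime ideals of $A$ with the topology generated by the sets $D(a)=\{\mathfrak p : a\notin\mathfrak p\}$, $a\in A$, and with $\mathcal O_X$ the sheafification (as a presheaf of partial rings) of $U\mapsto S_U^{-1}A$, where $S_U=\{a\in A : a\notin\mathfrak p\text{ for all }\mathfrak p\in U\}$. \textbf{Theorem.} Let $A$ be a partial ring, $(X,\mathcal O_X)=\operatorname{Spec}A$, $B=\mathcal O_X(X)$ and $(Y,\mathcal O_Y)=\operatorname{Spec}B$. Then $(X,\mathcal O_X)$ and $(Y,\mathcal O_Y)$ are isomorphic as locally partial-ringed spaces. -/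

import Mathlib

open CategoryTheory TopologicalSpace Opposite AlgebraicGeometry

universe u

noncomputable section

/-- A partial ring: a set with `0`, a subset `dom` of `A × A` (written `A₂`) and a map
`dom → A` making `A` a commutative unital partial monoid, with a commutative associative
unital multiplication which is bilinear. The multiplicative laws, including `0 * a = 0`, are
those of `CommMonoidWithZero`. -/
class PartialRing (A : Type u) extends CommMonoidWithZero A where
  /-- the set of summable pairs -/
  dom : Set (A × A)
  /-- the partial addition -/
  padd : dom → A
  zero_padd (a : A) : ∃ h : ((0 : A), a) ∈ dom, padd ⟨(0, a), h⟩ = a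
  padd_zero (a : A) : ∃ h : (a, (0 : A)) ∈ dom, padd ⟨(a, 0), h⟩ = a
  padd_comm (a b : A) (h : (a, b) ∈ dom) :
    ∃ h' : (b, a) ∈ dom, padd ⟨(a, b), h⟩ = padd ⟨(b, a), h'⟩
  dom_assoc (a b c : A) :
    (∃ h : (a, b) ∈ dom, (padd ⟨(a, b), h⟩, c) ∈ dom) ↔
      (∃ h : (b, c) ∈ dom, (a, padd ⟨(b, c), h⟩) ∈ dom)
  padd_assoc (a b c : A) (h : (a, b) ∈ dom) (k : (padd ⟨(a, b), h⟩, c) ∈ dom)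
    (h' : (b, c) ∈ dom) (k' : (a, padd ⟨(b, c), h'⟩) ∈ dom) :
    padd ⟨(padd ⟨(a, b), h⟩, c), k⟩ = padd ⟨(a, padd ⟨(b, c), h'⟩), k'⟩
  padd_mul (a b x : A) (h : (a, b) ∈ dom) :
    ∃ h' : (a * x, b * x) ∈ dom, padd ⟨(a * x, b * x), h'⟩ = padd ⟨(a, b), h⟩ * x

namespace PartialRing

/-- `IsSum a b c` : the pair `(a, b)` is summable and `a + b = c`. -/
def IsSum {A : Type u} [PartialRing A] (a b c : A) : Prop :=
  ∃ h : (a, b) ∈ dom (A := A), padd ⟨(a, b), h⟩ = c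

section

variable {A : Type u} [PartialRing A]

theorem IsSum.unique {a b c c' : A} (h : IsSum a b c) (h' : IsSum a b c') : c = c' := by
  obtain ⟨_, rfl⟩ := h
  obtain ⟨_, rfl⟩ := h'
  rfl

theorem isSum_zero (a : A) : IsSum 0 a a := zero_padd a

theorem IsSum.symm {a b c : A} (h : IsSum a b c) : IsSum b a c := by
  obtain ⟨h, rfl⟩ := h
  obtain ⟨h', e⟩ := padd_comm a b h
  exact ⟨h', e.symm⟩

theorem IsSum.mul {a b c : A} (h : IsSum a b c) (x : A) : IsSum (a * x) (b * x) (c * x) := by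
  obtain ⟨h, rfl⟩ := h
  exact padd_mul a b x h

theorem IsSum.assoc {a b c d e : A} (h : IsSum a b d) (k : IsSum d c e) :
    ∃ f, IsSum b c f ∧ IsSum a f e := by
  obtain ⟨h, rfl⟩ := h
  obtain ⟨k, rfl⟩ := k
  obtain ⟨h', k'⟩ := (dom_assoc a b c).1 ⟨h, k⟩
  exact ⟨_, ⟨h', rfl⟩, k', (padd_assoc a b c h k h' k').symm⟩

end

/-- The properties of the graph of an addition. -/
structure IsGraph {A : Type u} [CommMonoidWithZero A] (R : A → A → A → Prop) : Prop where
  unique {a b c c' : A} : R a b c → R a b c' → c = c'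
  zero (a : A) : R 0 a a
  symm {a b c : A} : R a b c → R b a c
  assoc {a b c d e : A} : R a b d → R d c e → ∃ f, R b c f ∧ R a f e
  mul {a b c : A} (x : A) : R a b c → R (a * x) (b * x) (c * x)

/-- A partial ring from the graph `R` of its addition: `R a b c` says that `(a, b)` is summable
with sum `c`. -/
abbrev ofGraph {A : Type u} [CommMonoidWithZero A] {R : A → A → A → Prop} (H : IsGraph R) : PartialRing A :=
  have key : ∀ {a b c} (h : ∃ c, R a b c), R a b c → h.choose = c :=
    fun h k => H.unique h.choose_spec k
  { dom := {p | ∃ c, R p.1 p.2 c}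
    padd := fun p => p.2.choose
    zero_padd := fun a => ⟨⟨a, H.zero a⟩, key _ (H.zero a)⟩
    padd_zero := fun a => ⟨⟨a, H.symm (H.zero a)⟩, key _ (H.symm (H.zero a))⟩
    padd_comm := fun a b h =>
      ⟨⟨_, H.symm h.choose_spec⟩, (key (a := b) (b := a) ⟨_, H.symm h.choose_spec⟩
        (H.symm h.choose_spec)).symm⟩
    dom_assoc := fun a b c => by
      constructor
      · rintro ⟨⟨d, hd⟩, ⟨e, he⟩⟩
        have e1 := key (a := a) (b := b) ⟨d, hd⟩ hd
        dsimp only at he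
        rw [e1] at he
        obtain ⟨f, hf, hf'⟩ := H.assoc hd he
        refine ⟨⟨f, hf⟩, e, ?_⟩
        have e2 := key (a := b) (b := c) ⟨f, hf⟩ hf
        dsimp only
        rw [e2]
        exact hf'
      · rintro ⟨⟨d, hd⟩, ⟨e, he⟩⟩
        have e1 := key (a := b) (b := c) ⟨d, hd⟩ hd
        dsimp only at he
        rw [e1] at he
        obtain ⟨f, hf, hf'⟩ := H.assoc (H.symm hd) (H.symm he)
        refine ⟨⟨f, H.symm hf⟩, e, ?_⟩
        have e2 := key (a := a) (b := b) ⟨f, H.symm hf⟩ (H.symm hf)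
        dsimp only
        rw [e2]
        exact H.symm hf'
    padd_assoc := fun a b c h k h' k' => by
      obtain ⟨f, hf, hf'⟩ := H.assoc h.choose_spec k.choose_spec
      have e1 := key h' hf
      refine (key (a := a) (b := h'.choose) k' ?_).symm
      rw [e1]
      exact hf'
    padd_mul := fun a b x h =>
      ⟨⟨_, H.mul x h.choose_spec⟩, key (a := a * x) (b := b * x) ⟨_, H.mul x h.choose_spec⟩
        (H.mul x h.choose_spec)⟩ }

theorem isSum_ofGraph {A : Type u} [CommMonoidWithZero A] {R : A → A → A → Prop} (H : IsGraph R) {a b c : A} :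
    @IsSum A (ofGraph H) a b c ↔ R a b c := by
  constructor
  · rintro ⟨h, rfl⟩
    exact Exists.choose_spec h
  · intro h
    exact ⟨⟨c, h⟩, H.unique (Exists.choose_spec (⟨c, h⟩ : ∃ c, R a b c)) h⟩

end PartialRing

open PartialRing

/-- Homomorphisms of partial rings. -/
structure PartialRingHom (A B : Type u) [PartialRing A] [PartialRing B] extends A →*₀ B where
  map_padd' (a b : A) (h : (a, b) ∈ dom (A := A)) :
    ∃ h' : (toFun a, toFun b) ∈ dom (A := B),
      toFun (padd ⟨(a, b), h⟩) = padd ⟨(toFun a, toFun b), h'⟩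

namespace PartialRingHom

variable {A B C : Type u} [PartialRing A] [PartialRing B] [PartialRing C]

instance : FunLike (PartialRingHom A B) A B where
  coe f := f.toFun
  coe_injective f g h := by
    obtain ⟨f, _⟩ := f
    obtain ⟨g, _⟩ := g
    have : f = g := DFunLike.coe_injective h
    subst this
    rfl

instance : MonoidWithZeroHomClass (PartialRingHom A B) A B where
  map_mul f := f.map_mul'
  map_one f := f.map_one'
  map_zero f := f.map_zero'

@[ext]
theorem ext {f g : PartialRingHom A B} (h : ∀ a, f a = g a) : f = g := DFunLike.ext _ _ h

theorem map_isSum (f : PartialRingHom A B) {a b c : A} (h : IsSum a b c) :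
    IsSum (f a) (f b) (f c) := by
  obtain ⟨h, rfl⟩ := h
  obtain ⟨h', e⟩ := f.map_padd' a b h
  exact ⟨h', e.symm⟩

/-- A homomorphism from its compatibility with the graphs of addition. -/
def mk' (f : A → B) (h0 : f 0 = 0) (h1 : f 1 = 1) (hm : ∀ a b, f (a * b) = f a * f b)
    (hs : ∀ a b c, IsSum a b c → IsSum (f a) (f b) (f c)) : PartialRingHom A B where
  toFun := f
  map_zero' := h0
  map_one' := h1
  map_mul' := hm
  map_padd' a b h := by
    obtain ⟨h', e⟩ := hs a b _ ⟨h, rfl⟩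
    exact ⟨h', e.symm⟩

@[simp]
theorem mk'_apply (f : A → B) (h0 : f 0 = 0) (h1 : f 1 = 1)
    (hm : ∀ a b, f (a * b) = f a * f b)
    (hs : ∀ a b c, IsSum a b c → IsSum (f a) (f b) (f c)) (a : A) :
    mk' f h0 h1 hm hs a = f a := rfl

/-- The identity. -/
def id (A : Type u) [PartialRing A] : PartialRingHom A A :=
  mk' (fun a => a) rfl rfl (fun _ _ => rfl) (fun _ _ _ h => h)

/-- Composition. -/
def comp (g : PartialRingHom B C) (f : PartialRingHom A B) : PartialRingHom A C :=
  mk' (fun a => g (f a)) (by simp) (by simp) (by simp)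
    (fun _ _ _ h => g.map_isSum (f.map_isSum h))

@[simp] theorem id_apply (a : A) : id A a = a := rfl

@[simp] theorem comp_apply (g : PartialRingHom B C) (f : PartialRingHom A B) (a : A) :
    comp g f a = g (f a) := rfl

end PartialRingHom

/-- The category of partial rings. -/
structure PRing : Type (u + 1) where
  /-- the underlying type -/
  carrier : Type u
  [str : PartialRing carrier]

namespace PRing

instance : CoeSort PRing.{u} (Type u) := ⟨carrier⟩

instance (A : PRing.{u}) : PartialRing A := A.str

instance : Category PRing.{u} where
  Hom A B := PartialRingHom A B
  id A := PartialRingHom.id A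
  comp f g := g.comp f

instance : ConcreteCategory PRing.{u} (fun A B => PartialRingHom A B) where
  hom f := f
  ofHom f := f

end PRing

/-! ### Ideals, local partial rings -/

/-- Ideals of a partial ring. -/
@[ext]
structure PIdeal (A : Type u) [PartialRing A] where
  /-- the underlying set -/
  carrier : Set A
  zero_mem' : (0 : A) ∈ carrier
  padd_mem' (a b : A) (h : (a, b) ∈ dom (A := A)) :
    a ∈ carrier → b ∈ carrier → padd ⟨(a, b), h⟩ ∈ carrier
  mul_mem' (a x : A) : x ∈ carrier → a * x ∈ carrier

namespace PIdeal

variable {A B : Type u} [PartialRing A] [PartialRing B]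

instance : SetLike (PIdeal A) A where
  coe := carrier
  coe_injective _ _ h := PIdeal.ext h

theorem zero_mem (I : PIdeal A) : (0 : A) ∈ I := I.zero_mem'

theorem mul_mem (I : PIdeal A) (a : A) {x : A} (h : x ∈ I) : a * x ∈ I := I.mul_mem' a x h

theorem mem_of_isSum (I : PIdeal A) {a b c : A} (h : IsSum a b c) (ha : a ∈ I) (hb : b ∈ I) :
    c ∈ I := by
  obtain ⟨h, rfl⟩ := h
  exact I.padd_mem' a b h ha hb

/-- Prime ideals. -/
structure IsPrime (I : PIdeal A) : Prop where
  ne_univ : (I : Set A) ≠ Set.univ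
  mem_or_mem (a b : A) : a * b ∈ I → a ∈ I ∨ b ∈ I

/-- Maximal ideals: maximal elements among the ideals different from `A`. -/
structure IsMaximal (I : PIdeal A) : Prop where
  ne_univ : (I : Set A) ≠ Set.univ
  eq_of_subset (J : PIdeal A) : (J : Set A) ≠ Set.univ → (I : Set A) ⊆ J → J = I

/-- The inverse image of an ideal. -/
def comap (f : PartialRingHom A B) (J : PIdeal B) : PIdeal A where
  carrier := f ⁻¹' J
  zero_mem' := by simpa using J.zero_mem
  padd_mem' a b h ha hb := J.mem_of_isSum (f.map_isSum ⟨h, rfl⟩) ha hb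
  mul_mem' a x h := by
    simp only [Set.mem_preimage, map_mul]
    exact J.mul_mem _ h

@[simp]
theorem mem_comap {f : PartialRingHom A B} {J : PIdeal B} {a : A} : a ∈ comap f J ↔ f a ∈ J :=
  Iff.rfl

theorem one_notMem {I : PIdeal A} (h : (I : Set A) ≠ Set.univ) : (1 : A) ∉ I := fun h1 =>
  h (Set.eq_univ_of_forall fun a => by simpa using I.mul_mem a h1)

end PIdeal

/-- Local partial rings: those with a unique maximal ideal. -/
def IsLocalPRing (A : Type u) [PartialRing A] : Prop := ∃! M : PIdeal A, M.IsMaximal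

/-- The maximal ideal of a local partial ring. -/
def IsLocalPRing.maximalIdeal {A : Type u} [PartialRing A] (h : IsLocalPRing A) :
    PIdeal A := h.choose

theorem IsLocalPRing.isMaximal {A : Type u} [PartialRing A] (h : IsLocalPRing A) :
    h.maximalIdeal.IsMaximal := h.choose_spec.1

theorem IsLocalPRing.eq_maximalIdeal {A : Type u} [PartialRing A] (h : IsLocalPRing A)
    {M : PIdeal A} (hM : M.IsMaximal) : M = h.maximalIdeal := h.choose_spec.2 M hM

/-- Homomorphisms of local partial rings. -/
def PartialRingHom.IsLocal {A B : Type u} [PartialRing A] [PartialRing B]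
    (f : PartialRingHom A B) (hA : IsLocalPRing A) (hB : IsLocalPRing B) : Prop :=
  PIdeal.comap f hB.maximalIdeal = hA.maximalIdeal

theorem PartialRingHom.IsLocal.comp {A B C : Type u} [PartialRing A] [PartialRing B]
    [PartialRing C] {f : PartialRingHom A B} {g : PartialRingHom B C} {hA : IsLocalPRing A}
    {hB : IsLocalPRing B} {hC : IsLocalPRing C} (hf : f.IsLocal hA hB) (hg : g.IsLocal hB hC) :
    (g.comp f).IsLocal hA hC := by
  unfold PartialRingHom.IsLocal at hf hg ⊢
  rw [← hf, ← hg]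
  rfl

/-- A criterion: a partial ring is local if it has a proper ideal whose complement consists
of units. -/
theorem IsLocalPRing.of_units {A : Type u} [PartialRing A] (M : PIdeal A)
    (h1 : (1 : A) ∉ M) (hM : ∀ a, a ∉ M → IsUnit a) : IsLocalPRing A := by
  have key : ∀ J : PIdeal A, (J : Set A) ≠ Set.univ → (J : Set A) ⊆ M := by
    intro J hJ a ha
    by_contra hc
    obtain ⟨b, hb⟩ := (hM a hc).exists_left_inv
    exact PIdeal.one_notMem hJ (hb ▸ J.mul_mem b ha)
  have hne : (M : Set A) ≠ Set.univ := fun h => h1 (h ▸ Set.mem_univ (1 : A) :)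
  refine ⟨M, ⟨hne, fun J hJ h => SetLike.coe_injective ((key J hJ).antisymm h)⟩, ?_⟩
  intro N hN
  exact (hN.eq_of_subset M hne (key N hN.ne_univ)).symm

/-! ### Localization

The underlying monoid of `S⁻¹A` is Mathlib's `Localization S`: its elements are the fractions
`a/s`, with `a/s = b/t` iff `u t a = u s b` for some `u ∈ S`. -/

namespace PLoc

variable {A : Type u} [PartialRing A] {S : Submonoid A}

open Localization

theorem mk_eq {a b : A} {s t : S} :
    mk a s = mk b t ↔ ∃ u : S, (u : A) * (t * a) = u * (s * b) := by
  rw [mk_eq_mk_iff, r_iff_exists]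

theorem mk_eq_smul (a : A) (s v : S) : mk a s = mk (v * a) (v * s) :=
  mk_eq.2 ⟨1, by simp [mul_comm, mul_left_comm]⟩

/-- The graph of the addition of `S⁻¹A`: `a/s + b/t = (uta + usb)/(ust)` as soon as
`(uta, usb) ∈ A₂`. -/
def Graph (x y z : Localization S) : Prop :=
  ∃ (a b : A) (s t u : S) (h : ((u * t * a : A), (u * s * b : A)) ∈ dom (A := A)),
    x = mk a s ∧ y = mk b t ∧ z = mk (padd ⟨_, h⟩) (u * s * t)

theorem graph_iff {x y z : Localization S} :
    Graph x y z ↔ ∃ (a b c : A) (s : S), IsSum a b c ∧ x = mk a s ∧ y = mk b s ∧ z = mk c s := by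
  constructor
  · rintro ⟨a, b, s, t, u, h, rfl, rfl, rfl⟩
    refine ⟨_, _, _, u * s * t, ⟨h, rfl⟩, ?_, ?_, rfl⟩
    · rw [mk_eq_smul a s (u * t)]
      congr 1
      ext; push_cast; ac_rfl
    · rw [mk_eq_smul b t (u * s)]
      congr 1
  · rintro ⟨a, b, c, s, h, rfl, rfl, rfl⟩
    have h2 := h.mul (s : A)
    obtain ⟨h3, e⟩ := h2
    have ea : ((1 : S) : A) * s * a = a * s := by simp [mul_comm]
    have eb : ((1 : S) : A) * s * b = b * s := by simp [mul_comm]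
    refine ⟨a, b, s, s, 1, by rw [ea, eb]; exact h3, rfl, rfl, ?_⟩
    simp only [ea, eb, e]
    rw [mk_eq_smul c s s]
    congr 1
    · exact mul_comm _ _
    · simp

/-- Two fractions have a common denominator. -/
theorem exists_common (x y : Localization S) :
    ∃ (a b : A) (s : S), x = mk a s ∧ y = mk b s := by
  induction x using Localization.induction_on with | _ p
  induction y using Localization.induction_on with | _ q
  refine ⟨q.2 * p.1, p.2 * q.1, p.2 * q.2, ?_, mk_eq_smul _ _ _⟩
  rw [mk_eq_smul p.1 p.2 q.2, mul_comm q.2]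

theorem Graph.of_mk {a b : A} {s t : S} {z : Localization S} (h : Graph (mk a s) (mk b t) z) :
    ∃ (u : S) (c : A), IsSum (u * t * a : A) (u * s * b) c ∧ z = mk c (u * s * t) := by
  obtain ⟨a', b', c, r, hs, e1, e2, rfl⟩ := graph_iff.1 h
  obtain ⟨v, hv⟩ := mk_eq.1 e1
  obtain ⟨w, hw⟩ := mk_eq.1 e2
  refine ⟨v * w * r, v * w * s * t * c, ?_, ?_⟩
  · have := hs.mul (v * w * s * t : A)
    convert this using 1
    · calc ((v * w * r : S) : A) * t * a = w * t * (v * (r * a)) := by push_cast; ac_rfl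
        _ = w * t * (v * (s * a')) := by rw [hv]
        _ = _ := by ac_rfl
    · calc ((v * w * r : S) : A) * s * b = v * s * (w * (r * b)) := by push_cast; ac_rfl
        _ = v * s * (w * (t * b')) := by rw [hw]
        _ = _ := by ac_rfl
    · ac_rfl
  · rw [mk_eq_smul c r (v * w * s * t)]
    congr 1
    ext; push_cast; ac_rfl

theorem Graph.unique {x y z z' : Localization S} (h : Graph x y z) (h' : Graph x y z') :
    z = z' := by
  obtain ⟨a, b, s, rfl, rfl⟩ := exists_common x y
  obtain ⟨u, c, hc, rfl⟩ := h.of_mk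
  obtain ⟨v, d, hd, rfl⟩ := h'.of_mk
  refine mk_eq.2 ⟨1, ?_⟩
  have h1 := hc.mul (v * s * s : A)
  have h2 := hd.mul (u * s * s : A)
  have e1 : (u * s * a : A) * (v * s * s) = (v * s * a : A) * (u * s * s) := by ac_rfl
  have e2 : (u * s * b : A) * (v * s * s) = (v * s * b : A) * (u * s * s) := by ac_rfl
  rw [e1, e2] at h1
  have := h1.unique h2
  push_cast
  rw [one_mul, one_mul, mul_comm _ c, mul_comm _ d, this]

theorem isGraph : IsGraph (Graph (S := S)) :=
  ⟨Graph.unique,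
    (fun a => by
      induction a using Localization.induction_on with | _ p
      exact graph_iff.2 ⟨0, p.1, p.1, p.2, isSum_zero _, (mk_zero _).symm, rfl, rfl⟩),
    (fun h => by
      obtain ⟨a, b, c, s, h, e1, e2, e3⟩ := graph_iff.1 h
      exact graph_iff.2 ⟨b, a, c, s, h.symm, e2, e1, e3⟩),
    (fun {x y z w v} h₀ k₀ => by
      obtain ⟨a, b, c, s, h, rfl, rfl, rfl⟩ := graph_iff.1 h₀
      induction z using Localization.induction_on with | _ p
      obtain ⟨d, t⟩ := p
      obtain ⟨u, e, k, rfl⟩ := k₀.of_mk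
      have h' := h.mul (u * t : A)
      rw [mul_comm c] at h'
      obtain ⟨f, h1, h2⟩ := h'.assoc k
      refine ⟨mk f (u * s * t), graph_iff.2 ⟨_, _, _, u * s * t, h1, ?_, ?_, rfl⟩,
        graph_iff.2 ⟨_, _, _, u * s * t, h2, ?_, rfl, rfl⟩⟩
      · rw [mk_eq_smul b s (u * t)]
        congr 1
        · push_cast; ac_rfl
        · ac_rfl
      · rw [mk_eq_smul d t (u * s)]
        rfl
      · rw [mk_eq_smul a s (u * t)]
        congr 1
        · push_cast; ac_rfl
        · ac_rfl),
    (fun {x y z} w h₀ => by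
      obtain ⟨a, b, c, s, h, rfl, rfl, rfl⟩ := graph_iff.1 h₀
      induction w using Localization.induction_on with | _ p
      exact graph_iff.2 ⟨_, _, _, s * p.2, h.mul p.1, mk_mul .., mk_mul .., mk_mul ..⟩)⟩

/-- The localization `S⁻¹A` as a partial ring. -/
instance : PartialRing (Localization S) := ofGraph isGraph

theorem isSum_iff_graph {x y z : Localization S} : IsSum x y z ↔ Graph x y z :=
  isSum_ofGraph isGraph

theorem isSum_iff {x y z : Localization S} : IsSum x y z ↔
    ∃ (a b c : A) (s : S), IsSum a b c ∧ x = mk a s ∧ y = mk b s ∧ z = mk c s :=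
  isSum_iff_graph.trans graph_iff

/-- The summable pairs of `S⁻¹A`. -/
theorem mk_mem_dom_iff {a b : A} {s t : S} :
    (mk a s, mk b t) ∈ dom (A := Localization S) ↔
      ∃ u : S, ((u * t * a : A), (u * s * b : A)) ∈ dom (A := A) := by
  constructor
  · intro h
    obtain ⟨u, c, ⟨h, _⟩, _⟩ := (isSum_iff_graph.1 ⟨h, rfl⟩).of_mk
    exact ⟨u, h⟩
  · rintro ⟨u, h⟩
    obtain ⟨h, _⟩ := isSum_iff_graph.2 ⟨a, b, s, t, u, h, rfl, rfl, rfl⟩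
    exact h

/-- The canonical map `S⁻¹A → T⁻¹A`, `a/s ↦ a/s`, for `S ⊆ T`. -/
def map {S T : Submonoid A} (h : S ≤ T) :
    PartialRingHom (Localization S) (Localization T) :=
  have hl : ∀ (a : A) (s : S), Localization.liftOn (mk a s)
      (fun a s => mk a (⟨s, h s.2⟩ : T)) (fun {a b s t} e => by
        obtain ⟨u, hu⟩ := r_iff_exists.1 e
        exact mk_eq.2 ⟨⟨u, h u.2⟩, hu⟩) = mk a ⟨s, h s.2⟩ := fun a s => liftOn_mk ..
  PartialRingHom.mk'
    (fun x => Localization.liftOn x (fun a s => mk a (⟨s, h s.2⟩ : T)) (fun {a b s t} e => by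
        obtain ⟨u, hu⟩ := r_iff_exists.1 e
        exact mk_eq.2 ⟨⟨u, h u.2⟩, hu⟩))
    (by rw [← mk_zero (1 : S), hl, mk_zero])
    (by rw [← mk_one, hl]; exact mk_one)
    (fun x y => by
      induction x using Localization.induction_on with | _ p
      induction y using Localization.induction_on with | _ q
      rw [mk_mul, hl, hl, hl, mk_mul]
      rfl)
    (fun x y z e₀ => by
      obtain ⟨a, b, c, s, e, rfl, rfl, rfl⟩ := isSum_iff.1 e₀
      rw [hl, hl, hl]
      exact isSum_iff.2 ⟨a, b, c, _, e, rfl, rfl, rfl⟩)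

@[simp]
theorem map_mk {S T : Submonoid A} (h : S ≤ T) (a : A) (s : S) :
    map h (mk a s) = mk a ⟨s, h s.2⟩ := by
  rw [map, PartialRingHom.mk'_apply, liftOn_mk]

end PLoc

/-! ### Stalks of presheaves of partial rings -/

namespace PStalk

variable {X : TopCat.{u}} (F : TopCat.Presheaf PRing.{u} X)

/-- Restriction of sections. -/
abbrev res {U V : Opens X} (h : V ≤ U) : PartialRingHom (F.obj (op U)) (F.obj (op V)) :=
  F.map (homOfLE h).op

theorem res_id {U : Opens X} (a : F.obj (op U)) : res F (le_refl U) a = a := by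
  have : F.map (homOfLE (le_refl U)).op = 𝟙 _ := F.map_id (op U)
  change (F.map (homOfLE (le_refl U)).op : PartialRingHom _ _) a = a
  rw [this]
  rfl

theorem res_res {U V W : Opens X} (h : V ≤ U) (k : W ≤ V) (a : F.obj (op U)) :
    res F k (res F h a) = res F (k.trans h) a := by
  have : F.map (homOfLE (k.trans h)).op = F.map (homOfLE h).op ≫ F.map (homOfLE k).op :=
    F.map_comp (homOfLE h).op (homOfLE k).op
  change _ = (F.map (homOfLE (k.trans h)).op : PartialRingHom _ _) a
  rw [this]
  rfl

variable (x : X)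

/-- Sections of `F` on some open neighbourhood of `x`. -/
structure LocalSection where
  /-- the neighbourhood -/
  U : Opens X
  mem : x ∈ U
  /-- the section -/
  s : F.obj (op U)

/-- Two local sections are identified when they agree on a smaller neighbourhood of `x`. -/
instance setoid : Setoid (LocalSection F x) where
  r a b := ∃ (W : Opens X) (_ : x ∈ W) (h : W ≤ a.U) (k : W ≤ b.U), res F h a.s = res F k b.s
  iseqv :=
    { refl := fun a => ⟨a.U, a.mem, le_rfl, le_rfl, rfl⟩
      symm := fun ⟨W, hx, h, k, e⟩ => ⟨W, hx, k, h, e.symm⟩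
      trans := by
        rintro a b c ⟨W, hx, h, k, e⟩ ⟨W', hx', h', k', e'⟩
        refine ⟨W ⊓ W', ⟨hx, hx'⟩, inf_le_left.trans h, inf_le_right.trans k', ?_⟩
        rw [← res_res F h inf_le_left, e, res_res, ← res_res F k' inf_le_right, ← e', res_res] }

end PStalk

/-- The stalk at `x` of a presheaf of partial rings: the filtered colimit of the `F(U)`, `x ∈ U`. -/
def PStalk {X : TopCat.{u}} (F : TopCat.Presheaf PRing.{u} X) (x : X) : Type u :=
  Quotient (PStalk.setoid F x)

namespace PStalk

variable {X : TopCat.{u}} (F : TopCat.Presheaf PRing.{u} X) {x : X}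

/-- The germ at `x` of a section. -/
def germ {U : Opens X} (hx : x ∈ U) (s : F.obj (op U)) : PStalk F x :=
  Quotient.mk _ ⟨U, hx, s⟩

variable {F}

theorem germ_res {U V : Opens X} (h : V ≤ U) (hx : x ∈ V) (s : F.obj (op U)) :
    germ F hx (res F h s) = germ F (h hx) s :=
  Quotient.sound ⟨V, hx, le_rfl, h, res_id ..⟩

theorem germ_eq {U V : Opens X} {hx : x ∈ U} {hx' : x ∈ V} {s : F.obj (op U)}
    {t : F.obj (op V)} : germ F hx s = germ F hx' t ↔
      ∃ (W : Opens X) (_ : x ∈ W) (h : W ≤ U) (k : W ≤ V), res F h s = res F k t :=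
  ⟨fun h => Quotient.exact h, fun h => Quotient.sound h⟩

theorem exists_germ (g : PStalk F x) :
    ∃ (U : Opens X) (hx : x ∈ U) (s : F.obj (op U)), germ F hx s = g := by
  obtain ⟨⟨U, hx, s⟩, rfl⟩ := Quotient.exists_rep g
  exact ⟨U, hx, s, rfl⟩

/-- Two germs come from sections on a common neighbourhood. -/
theorem exists_germ₂ (g h : PStalk F x) :
    ∃ (U : Opens X) (hx : x ∈ U) (s t : F.obj (op U)), germ F hx s = g ∧ germ F hx t = h := by
  obtain ⟨U, hU, s, rfl⟩ := exists_germ g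
  obtain ⟨V, hV, t, rfl⟩ := exists_germ h
  exact ⟨U ⊓ V, ⟨hU, hV⟩, res F inf_le_left s, res F inf_le_right t, germ_res .., germ_res ..⟩

instance : Mul (PStalk F x) where
  mul := Quotient.map₂
    (fun a b => ⟨a.U ⊓ b.U, ⟨a.mem, b.mem⟩, res F inf_le_left a.s * res F inf_le_right b.s⟩) <| by
      rintro a a' ⟨W, hx, h, k, e⟩ b b' ⟨W', hx', h', k', e'⟩
      refine ⟨W ⊓ W', ⟨hx, hx'⟩, inf_le_inf h h', inf_le_inf k k', ?_⟩
      simp only [map_mul, res_res]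
      rw [← res_res F h inf_le_left, e, res_res, ← res_res F h' inf_le_right, e', res_res]

instance : One (PStalk F x) := ⟨germ F (U := ⊤) trivial 1⟩

instance : Zero (PStalk F x) := ⟨germ F (U := ⊤) trivial 0⟩

theorem germ_mul {U : Opens X} (hx : x ∈ U) (s t : F.obj (op U)) :
    germ F hx (s * t) = germ F hx s * germ F hx t := by
  refine Quotient.sound ⟨U, hx, le_rfl, le_inf le_rfl le_rfl, ?_⟩
  simp only [map_mul, res_res]

theorem germ_one {U : Opens X} (hx : x ∈ U) : germ F hx 1 = 1 :=
  Quotient.sound ⟨U, hx, le_rfl, le_top, by simp only [map_one]⟩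

theorem germ_zero {U : Opens X} (hx : x ∈ U) : germ F hx 0 = 0 :=
  Quotient.sound ⟨U, hx, le_rfl, le_top, by simp only [map_zero]⟩

instance : CommMonoidWithZero (PStalk F x) where
  mul_assoc a b c := by
    obtain ⟨U, hU, a, b, rfl, rfl⟩ := exists_germ₂ a b
    obtain ⟨V, hV, c, rfl⟩ := exists_germ c
    have hx : x ∈ U ⊓ V := ⟨hU, hV⟩
    rw [← germ_res inf_le_left hx a, ← germ_res inf_le_left hx b, ← germ_res inf_le_right hx c]
    simp only [← germ_mul, mul_assoc]
  mul_comm a b := by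
    obtain ⟨U, hU, a, b, rfl, rfl⟩ := exists_germ₂ a b
    rw [← germ_mul, ← germ_mul, mul_comm]
  one_mul a := by
    obtain ⟨U, hU, a, rfl⟩ := exists_germ a
    rw [← germ_one hU, ← germ_mul, one_mul]
  mul_one a := by
    obtain ⟨U, hU, a, rfl⟩ := exists_germ a
    rw [← germ_one hU, ← germ_mul, mul_one]
  zero_mul a := by
    obtain ⟨U, hU, a, rfl⟩ := exists_germ a
    rw [← germ_zero hU, ← germ_mul, zero_mul]
  mul_zero a := by
    obtain ⟨U, hU, a, rfl⟩ := exists_germ a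
    rw [← germ_zero hU, ← germ_mul, mul_zero]

/-- The graph of the addition of the stalk: germs are added by adding sections which represent
them on a common neighbourhood. -/
def Graph (a b c : PStalk F x) : Prop :=
  ∃ (U : Opens X) (hx : x ∈ U) (s t r : F.obj (op U)),
    IsSum s t r ∧ a = germ F hx s ∧ b = germ F hx t ∧ c = germ F hx r

/-- The graph, for given representatives of the summands. -/
theorem Graph.exists {U : Opens X} {hx : x ∈ U} {s t : F.obj (op U)} {c : PStalk F x}
    (h : Graph (germ F hx s) (germ F hx t) c) :
    ∃ (V : Opens X) (hV : x ∈ V) (k : V ≤ U) (r : F.obj (op V)),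
      IsSum (res F k s) (res F k t) r ∧ c = germ F hV r := by
  obtain ⟨U', hx', s', t', r, h, e1, e2, rfl⟩ := h
  obtain ⟨W, hW, h1, k1, e1⟩ := germ_eq.1 e1
  obtain ⟨W', hW', h2, k2, e2⟩ := germ_eq.1 e2
  refine ⟨W ⊓ W', ⟨hW, hW'⟩, inf_le_left.trans h1, res F (inf_le_left.trans k1) r, ?_,
    (germ_res (inf_le_left.trans k1) _ r).symm⟩
  have := (res F ((inf_le_left : W ⊓ W' ≤ W).trans k1)).map_isSum h
  rw [← res_res F k1 inf_le_left s', ← e1, res_res] at this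
  convert this using 1
  calc res F (inf_le_left.trans h1) t = res F inf_le_right (res F h2 t) := (res_res ..).symm
    _ = res F inf_le_right (res F k2 t') := by rw [e2]
    _ = _ := res_res ..

theorem isGraph : IsGraph (Graph (F := F) (x := x)) :=
  ⟨    (fun {a b c c'} h h' => by
      obtain ⟨U, hU, a, b, rfl, rfl⟩ := exists_germ₂ a b
      obtain ⟨V, hV, k, r, hr, rfl⟩ := h.exists
      obtain ⟨V', hV', k', r', hr', rfl⟩ := h'.exists
      refine germ_eq.2 ⟨V ⊓ V', ⟨hV, hV'⟩, inf_le_left, inf_le_right, ?_⟩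
      have h1 := (res F (inf_le_left : V ⊓ V' ≤ V)).map_isSum hr
      have h2 := (res F (inf_le_right : V ⊓ V' ≤ V')).map_isSum hr'
      rw [res_res, res_res] at h1 h2
      exact h1.unique h2),
    (fun a => by
      obtain ⟨U, hU, a, rfl⟩ := exists_germ a
      exact ⟨U, hU, 0, a, a, isSum_zero a, (germ_zero hU).symm, rfl, rfl⟩),
    (fun ⟨U, hU, s, t, r, h, e1, e2, e3⟩ => ⟨U, hU, t, s, r, h.symm, e2, e1, e3⟩),
    (fun {a b c d e} h k => by
      obtain ⟨U, hU, a, b, d, h, rfl, rfl, rfl⟩ := h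
      obtain ⟨V, hV, c, rfl⟩ := exists_germ c
      have hx : x ∈ U ⊓ V := ⟨hU, hV⟩
      rw [← germ_res inf_le_left hx d, ← germ_res inf_le_right hx c] at k
      obtain ⟨W, hW, l, r, hr, rfl⟩ := k.exists
      have h' := (res F (l.trans inf_le_left)).map_isSum h
      rw [res_res, res_res] at hr
      obtain ⟨f, h1, h2⟩ := h'.assoc hr
      exact ⟨germ F hW f, ⟨W, hW, _, _, _, h1, (germ_res (l.trans inf_le_left) hW b).symm,
          (germ_res (l.trans inf_le_right) hW c).symm, rfl⟩,
        ⟨W, hW, _, _, _, h2, (germ_res (l.trans inf_le_left) hW a).symm, rfl, rfl⟩⟩),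
    (fun {a b c} y ⟨U, hU, s, t, r, h, e1, e2, e3⟩ => by
      subst e1 e2 e3
      obtain ⟨V, hV, y, rfl⟩ := exists_germ y
      have hx : x ∈ U ⊓ V := ⟨hU, hV⟩
      rw [← germ_res inf_le_left hx s, ← germ_res inf_le_left hx t, ← germ_res inf_le_left hx r,
        ← germ_res inf_le_right hx y]
      exact ⟨U ⊓ V, hx, _, _, _, ((res F inf_le_left).map_isSum h).mul _,
        (germ_mul ..).symm, (germ_mul ..).symm, (germ_mul ..).symm⟩)⟩

instance : PartialRing (PStalk F x) := ofGraph isGraph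

theorem isSum_iff {a b c : PStalk F x} : IsSum a b c ↔
    ∃ (U : Opens X) (hx : x ∈ U) (s t r : F.obj (op U)),
      IsSum s t r ∧ a = germ F hx s ∧ b = germ F hx t ∧ c = germ F hx r :=
  isSum_ofGraph isGraph

theorem germ_isSum {U : Opens X} (hx : x ∈ U) {s t r : F.obj (op U)} (h : IsSum s t r) :
    IsSum (germ F hx s) (germ F hx t) (germ F hx r) :=
  isSum_iff.2 ⟨U, hx, s, t, r, h, rfl, rfl, rfl⟩

theorem exists_of_isSum {U : Opens X} {hx : x ∈ U} {s t : F.obj (op U)} {c : PStalk F x}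
    (h : IsSum (germ F hx s) (germ F hx t) c) :
    ∃ (V : Opens X) (hV : x ∈ V) (k : V ≤ U) (r : F.obj (op V)),
      IsSum (res F k s) (res F k t) r ∧ c = germ F hV r :=
  Graph.exists (isSum_iff.1 h)

/-- A homomorphism out of a stalk, from a family of homomorphisms out of the sections which
is compatible with restriction. -/
def desc {B : Type u} [PartialRing B]
    (φ : ∀ (U : Opens X) (_ : x ∈ U), PartialRingHom (F.obj (op U)) B)
    (hφ : ∀ (U V : Opens X) (hU : x ∈ U) (hV : x ∈ V) (h : V ≤ U) (s : F.obj (op U)),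
      φ V hV (res F h s) = φ U hU s) : PartialRingHom (PStalk F x) B :=
  PartialRingHom.mk'
    (Quotient.lift (fun a : LocalSection F x => φ a.U a.mem a.s) (by
      rintro a b ⟨W, hx, h, k, e⟩
      rw [← hφ a.U W a.mem hx h, e, hφ]))
    (map_zero (φ ⊤ trivial)) (map_one (φ ⊤ trivial))
    (fun a b => by
      obtain ⟨U, hU, a, b, rfl, rfl⟩ := exists_germ₂ a b
      rw [← germ_mul]
      exact map_mul (φ U hU) a b)
    (fun a b c h => by
      obtain ⟨U, hU, s, t, r, h', rfl, rfl, rfl⟩ := isSum_iff.1 h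
      exact (φ U hU).map_isSum h')

@[simp]
theorem desc_germ {B : Type u} [PartialRing B]
    (φ : ∀ (U : Opens X) (_ : x ∈ U), PartialRingHom (F.obj (op U)) B)
    (hφ : ∀ (U V : Opens X) (hU : x ∈ U) (hV : x ∈ V) (h : V ≤ U) (s : F.obj (op U)),
      φ V hV (res F h s) = φ U hU s) {U : Opens X} (hU : x ∈ U) (s : F.obj (op U)) :
    desc φ hφ (germ F hU s) = φ U hU s := rfl

variable (F x) in
/-- The germ map as a homomorphism. -/
def germHom (U : Opens X) (hx : x ∈ U) : PartialRingHom (F.obj (op U)) (PStalk F x) :=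
  PartialRingHom.mk' (germ F hx) (germ_zero hx) (germ_one hx) (germ_mul hx)
    (fun _ _ _ h => germ_isSum hx h)

end PStalk

/-! ### Sheafification -/

namespace PSheafify

open PStalk

variable {X : TopCat.{u}} (F : TopCat.Presheaf PRing.{u} X)

/-- The families of germs on `U` which are locally given by sections of `F`. -/
def Sections (U : Opens X) : Type u :=
  {s : ∀ x : U, PStalk F x.1 // ∀ x : U, ∃ (V : Opens X) (_ : x.1 ∈ V) (h : V ≤ U)
    (a : F.obj (op V)), ∀ y : V, s ⟨y.1, h y.2⟩ = germ F y.2 a}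

variable {F}

namespace Sections

variable {U : Opens X}

instance : CoeFun (Sections F U) (fun _ => ∀ x : U, PStalk F x.1) := ⟨Subtype.val⟩

@[ext]
theorem ext {s t : Sections F U} (h : ∀ x, s x = t x) : s = t := Subtype.ext (funext h)

/-- The section of the sheafification given by a section of the presheaf. -/
def ofSection (a : F.obj (op U)) : Sections F U :=
  ⟨fun x => germ F x.2 a, fun x => ⟨U, x.2, le_rfl, a, fun _ => rfl⟩⟩

instance : Mul (Sections F U) where
  mul s t := ⟨fun x => s x * t x, fun x => by
    obtain ⟨V, hV, h, a, ha⟩ := s.2 x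
    obtain ⟨W, hW, k, b, hb⟩ := t.2 x
    refine ⟨V ⊓ W, ⟨hV, hW⟩, inf_le_left.trans h, res F inf_le_left a * res F inf_le_right b, ?_⟩
    intro y
    rw [germ_mul, germ_res, germ_res]
    exact congrArg₂ _ (ha ⟨y.1, y.2.1⟩) (hb ⟨y.1, y.2.2⟩)⟩

instance : One (Sections F U) :=
  ⟨fun _ => 1, fun x => ⟨U, x.2, le_rfl, 1, fun y => (germ_one y.2).symm⟩⟩

instance : Zero (Sections F U) :=
  ⟨fun _ => 0, fun x => ⟨U, x.2, le_rfl, 0, fun y => (germ_zero y.2).symm⟩⟩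

@[simp] theorem mul_apply (s t : Sections F U) (x : U) : (s * t) x = s x * t x := rfl
@[simp] theorem one_apply (x : U) : (1 : Sections F U) x = 1 := rfl
@[simp] theorem zero_apply (x : U) : (0 : Sections F U) x = 0 := rfl

instance : CommMonoidWithZero (Sections F U) where
  mul_assoc a b c := by ext x; simp [mul_assoc]
  mul_comm a b := by ext x; simp [mul_comm]
  one_mul a := by ext x; simp
  mul_one a := by ext x; simp
  zero_mul a := by ext x; simp
  mul_zero a := by ext x; simp

/-- The graph of the addition: two sections are summable when they are so in every stalk. -/
def Graph (s t r : Sections F U) : Prop := ∀ x, IsSum (s x) (t x) (r x)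

theorem exists_graph (s t : Sections F U) (h : ∀ x, ∃ c, IsSum (s x) (t x) c) :
    ∃ r, Graph s t r := by
  choose r hr using h
  refine ⟨⟨r, fun x => ?_⟩, hr⟩
  obtain ⟨V, hV, h, a, ha⟩ := s.2 x
  obtain ⟨W, hW, k, b, hb⟩ := t.2 x
  have hx : x.1 ∈ V ⊓ W := ⟨hV, hW⟩
  have h1 := hr x
  have e1 : s x = germ F hx (res F inf_le_left a) := by rw [germ_res]; exact ha ⟨x.1, hV⟩
  have e2 : t x = germ F hx (res F inf_le_right b) := by rw [germ_res]; exact hb ⟨x.1, hW⟩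
  rw [e1, e2] at h1
  obtain ⟨Z, hZ, l, c, hc, _⟩ := exists_of_isSum h1
  refine ⟨Z, hZ, l.trans (inf_le_left.trans h), c, fun y => ?_⟩
  have h2 := hr ⟨y.1, (l.trans (inf_le_left.trans h)) y.2⟩
  have h3 := germ_isSum y.2 hc
  rw [germ_res, germ_res, germ_res, germ_res] at h3
  refine h2.unique ?_
  convert h3 using 1
  · exact ha ⟨y.1, (l y.2).1⟩
  · exact hb ⟨y.1, (l y.2).2⟩

theorem isGraph : IsGraph (Graph (F := F) (U := U)) :=
  ⟨(fun h h' => by ext x; exact (h x).unique (h' x)),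
    (fun a x => isSum_zero (a x)),
    (fun h x => (h x).symm),
    (fun {a b c d e} h k => by
      obtain ⟨f, hf⟩ := exists_graph b c (fun x => by
        obtain ⟨f, hf, _⟩ := (h x).assoc (k x)
        exact ⟨f, hf⟩)
      refine ⟨f, hf, fun x => ?_⟩
      obtain ⟨f', hf', hf''⟩ := (h x).assoc (k x)
      rw [(hf x).unique hf']
      exact hf''),
    (fun y h x => (h x).mul (y x))⟩

instance : PartialRing (Sections F U) := ofGraph isGraph

theorem isSum_iff {s t r : Sections F U} : IsSum s t r ↔ ∀ x, IsSum (s x) (t x) (r x) :=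
  isSum_ofGraph isGraph

/-- Restriction of sections of the sheafification. -/
def restrict {V : Opens X} (h : V ≤ U) : PartialRingHom (Sections F U) (Sections F V) :=
  PartialRingHom.mk'
    (fun s => ⟨fun x => s ⟨x.1, h x.2⟩, fun x => by
      obtain ⟨W, hW, k, a, ha⟩ := s.2 ⟨x.1, h x.2⟩
      refine ⟨W ⊓ V, ⟨hW, x.2⟩, inf_le_right, res F inf_le_left a, fun y => ?_⟩
      rw [germ_res]
      exact ha ⟨y.1, y.2.1⟩⟩)
    rfl rfl (fun _ _ => rfl)
    (fun _ _ _ e => isSum_iff.2 fun x => isSum_iff.1 e ⟨x.1, h x.2⟩)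

@[simp] theorem restrict_apply {V : Opens X} (h : V ≤ U) (s : Sections F U) (x : V) :
    restrict h s x = s ⟨x.1, h x.2⟩ := rfl

end Sections

end PSheafify

open PSheafify in
/-- The sheafification of a presheaf of partial rings. -/
def PSheafify {X : TopCat.{u}} (F : TopCat.Presheaf PRing.{u} X) :
    TopCat.Presheaf PRing.{u} X where
  obj U := ⟨Sections F U.unop⟩
  map i := Sections.restrict i.unop.le
  map_id _ := rfl
  map_comp _ _ := rfl

namespace PSheafify

open PStalk

variable {X : TopCat.{u}} (F : TopCat.Presheaf PRing.{u} X)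

theorem isSheaf : (PSheafify F).IsSheaf := by
  intro E
  rw [← isSheaf_iff_isSheaf_of_type]
  change TopCat.Presheaf.IsSheaf (PSheafify F ⋙ coyoneda.obj (op E))
  apply TopCat.Presheaf.isSheaf_of_isSheafUniqueGluing_types
  intro ι U sf hsf
  let σ : ∀ i, PartialRingHom E (Sections F (U i)) := sf
  have hσ : ∀ (i j : ι) (e : E) (x : X) (hi : x ∈ U i) (hj : x ∈ U j),
      σ i e ⟨x, hi⟩ = σ j e ⟨x, hj⟩ := by
    intro i j e x hi hj
    have h1 : (Sections.restrict (inf_le_left : U i ⊓ U j ≤ U i)).comp (σ i) =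
      (Sections.restrict (inf_le_right : U i ⊓ U j ≤ U j)).comp (σ j) := hsf i j
    have h2 := congrArg (fun f => f e) (congrArg DFunLike.coe h1)
    exact congrArg (fun s : Sections F (U i ⊓ U j) => s ⟨x, hi, hj⟩) h2
  have hc : ∀ x : (iSup U : Opens X), ∃ i, x.1 ∈ U i := fun x => Opens.mem_iSup.1 x.2
  choose c hc using hc
  let g : E → Sections F (iSup U) := fun e => ⟨fun x => σ (c x) e ⟨x.1, hc x⟩, fun x => by
    obtain ⟨V, hV, h, a, ha⟩ := (σ (c x) e).2 ⟨x.1, hc x⟩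
    refine ⟨V, hV, h.trans (le_iSup U _), a, fun y => ?_⟩
    rw [← ha y]
    exact hσ ..⟩
  let G : PartialRingHom E (Sections F (iSup U)) := PartialRingHom.mk' g
    (by ext x; change σ _ 0 _ = _; rw [map_zero]; rfl)
    (by ext x; change σ _ 1 _ = _; rw [map_one]; rfl)
    (fun a b => by ext x; change σ _ (a * b) _ = _; rw [map_mul]; rfl)
    (fun a b r h => Sections.isSum_iff.2 fun x =>
      Sections.isSum_iff.1 ((σ (c x)).map_isSum h) ⟨x.1, hc x⟩)
  refine ⟨G, ?_, ?_⟩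
  · intro i
    change (Sections.restrict (le_iSup U i)).comp G = σ i
    ext e x
    exact hσ ..
  · intro G' hG'
    let G'' : PartialRingHom E (Sections F (iSup U)) := G'
    change G'' = G
    ext e x
    have h1 : (Sections.restrict (le_iSup U (c x))).comp G'' = σ (c x) := hG' (c x)
    have h2 := congrArg (fun f => f e) (congrArg DFunLike.coe h1)
    exact congrArg (fun s : Sections F (U (c x)) => s ⟨x.1, hc x⟩) h2

/-- Evaluation of the germs of sections of the sheafification. -/
def stalkEval (x : X) : PartialRingHom (PStalk (PSheafify F) x) (PStalk F x) :=
  PStalk.desc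
    (fun U hx => PartialRingHom.mk' (fun s : Sections F U => s ⟨x, hx⟩) rfl rfl
      (fun _ _ => rfl) (fun _ _ _ h => Sections.isSum_iff.1 h _))
    (fun _ _ _ _ _ _ => rfl)

theorem isUnit_of_stalkEval (x : X) (g : PStalk (PSheafify F) x) (h : IsUnit (stalkEval F x g)) :
    IsUnit g := by
  obtain ⟨U, hx, s, rfl⟩ := exists_germ g
  let s' : Sections F U := s
  obtain ⟨V, hV, hVU, a, ha⟩ := s'.2 ⟨x, hx⟩
  obtain ⟨b, hb⟩ := h.exists_right_inv
  have e1 : stalkEval F x (germ (PSheafify F) hx s) = germ F hV a := ha ⟨x, hV⟩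
  rw [e1] at hb
  obtain ⟨W, hW, b, rfl⟩ := exists_germ b
  have hx' : x ∈ V ⊓ W := ⟨hV, hW⟩
  rw [← germ_res inf_le_left hx' a, ← germ_res inf_le_right hx' b, ← germ_mul,
    ← germ_one hx'] at hb
  obtain ⟨Z, hZ, h1, h2, e⟩ := germ_eq.1 hb
  rw [map_mul, map_one, res_res, res_res] at e
  let t : (PSheafify F).obj (op Z) := Sections.ofSection (res F (h1.trans inf_le_right) b)
  refine IsUnit.of_mul_eq_one (germ (PSheafify F) hZ t) ?_
  rw [← germ_res (h1.trans (inf_le_left.trans hVU)) hZ s, ← germ_mul, ← germ_one hZ]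
  congr 1
  apply Sections.ext
  intro y
  change s' ⟨y.1, _⟩ * germ F y.2 _ = 1
  have e2 : s' ⟨y.1, hVU (h1 y.2).1⟩ = germ F y.2 (res F (h1.trans inf_le_left) a) := by
    rw [germ_res]
    exact ha ⟨y.1, (h1 y.2).1⟩
  rw [e2, ← germ_mul, e, germ_one]

end PSheafify

/-! ### Locally partial-ringed spaces -/

/-- A locally partial-ringed space: a topological space with a sheaf of partial rings whose
stalks are local. -/
structure LocallyPRingedSpace extends SheafedSpace PRing.{u} where
  isLocal (x : carrier) : IsLocalPRing (PStalk presheaf x)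

namespace LocallyPRingedSpace

/-- The map on stalks `o_{Y, f x} → o_{X, x}` induced by a morphism `f : X ⟶ Y`. -/
def stalkMap {X Y : PresheafedSpace PRing.{u}} (f : X ⟶ Y) (x : X) :
    PartialRingHom (PStalk Y.presheaf (f.base x)) (PStalk X.presheaf x) :=
  PStalk.desc
    (fun V hV => (PStalk.germHom X.presheaf x ((Opens.map f.base).obj V) hV).comp (f.c.app (op V)))
    (fun U V hU hV h s => by
      have h1 := f.c.naturality (homOfLE h).op
      have h2 : (f.c.app (op V) : PartialRingHom _ _) (PStalk.res Y.presheaf h s) =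
          PStalk.res X.presheaf (U := (Opens.map f.base).obj U) (V := (Opens.map f.base).obj V)
            (fun _ hy => h hy) ((f.c.app (op U) : PartialRingHom _ _) s) :=
        congrArg (fun k => k s) (congrArg DFunLike.coe
          (show PartialRingHom.comp _ _ = PartialRingHom.comp _ _ from h1))
      exact (congrArg (PStalk.germ X.presheaf (U := (Opens.map f.base).obj V) hV) h2).trans
        (PStalk.germ_res (F := X.presheaf) (U := (Opens.map f.base).obj U)
          (V := (Opens.map f.base).obj V) (fun _ hy => h hy) hV _))

/-- Morphisms of locally partial-ringed spaces: a continuous map `f : X → Y` and a morphism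
`𝒪_Y ⟶ f_* 𝒪_X` inducing homomorphisms of local partial rings on the stalks. -/
@[ext]
structure Hom (X Y : LocallyPRingedSpace.{u}) where
  /-- the underlying morphism of spaces with presheaves of partial rings -/
  hom : X.toPresheafedSpace ⟶ Y.toPresheafedSpace
  isLocal (x : X.carrier) : (stalkMap hom x).IsLocal (Y.isLocal (hom.base x)) (X.isLocal x)

instance : Category LocallyPRingedSpace.{u} where
  Hom := Hom
  id X := ⟨𝟙 _, fun x => by
    have h : stalkMap (𝟙 X.toPresheafedSpace) x = PartialRingHom.id _ := by
      ext g
      obtain ⟨U, hU, s, rfl⟩ := PStalk.exists_germ g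
      rfl
    unfold PartialRingHom.IsLocal
    rw [h]
    rfl⟩
  comp {X Y Z} f g := ⟨f.hom ≫ g.hom, fun x => by
    have h : stalkMap (f.hom ≫ g.hom) x =
        (stalkMap f.hom x).comp (stalkMap g.hom (f.hom.base x)) := by
      ext a
      obtain ⟨U, hU, s, rfl⟩ := PStalk.exists_germ a
      rfl
    rw [h]
    exact (g.isLocal (f.hom.base x)).comp (f.isLocal x)⟩

/-- The partial ring of global sections. -/
abbrev Γ (X : LocallyPRingedSpace.{u}) : PRing.{u} := X.presheaf.obj (op ⊤)

end LocallyPRingedSpace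

/-! ### The spectrum -/

/-- The set of prime ideals of a partial ring. -/
@[ext]
structure PSpec (A : Type u) [PartialRing A] where
  /-- the ideal -/
  ideal : PIdeal A
  isPrime : ideal.IsPrime

namespace PSpec

variable (A : Type u) [PartialRing A]

variable {A} in
/-- The set `D(a)` of prime ideals which do not contain `a`. -/
def basicOpen (a : A) : Set (PSpec A) := {p | a ∉ p.ideal}

/-- The Zariski topology, generated by the sets `D(a)`. -/
instance : TopologicalSpace (PSpec A) :=
  TopologicalSpace.generateFrom (Set.range basicOpen)

variable {A} in
theorem isOpen_basicOpen (a : A) : IsOpen (basicOpen a) :=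
  TopologicalSpace.isOpen_generateFrom_of_mem ⟨a, rfl⟩

variable {A} in
/-- The multiplicative set `S_U` of the elements which lie in no prime ideal `p ∈ U`. -/
def nonvanishing (U : Set (PSpec A)) : Submonoid A where
  carrier := {a | ∀ p ∈ U, a ∉ p.ideal}
  one_mem' p _ := PIdeal.one_notMem p.isPrime.ne_univ
  mul_mem' ha hb p hp h := (p.isPrime.mem_or_mem _ _ h).elim (ha p hp) (hb p hp)

variable {A} in
theorem nonvanishing_anti {U V : Set (PSpec A)} (h : V ⊆ U) :
    nonvanishing U ≤ nonvanishing V := fun _ ha p hp => ha p (h hp)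

/-- The presheaf `U ↦ S_U⁻¹ A`. -/
def presheaf : TopCat.Presheaf PRing.{u} (TopCat.of (PSpec A)) where
  obj U := ⟨Localization (nonvanishing (U.unop : Set (PSpec A)))⟩
  map i := PLoc.map (nonvanishing_anti i.unop.le)
  map_id U := by
    refine PartialRingHom.ext fun a => ?_
    induction a using Localization.induction_on with | _ p
    exact PLoc.map_mk ..
  map_comp i j := by
    refine PartialRingHom.ext fun a => ?_
    induction a using Localization.induction_on with | _ p
    refine (PLoc.map_mk ..).trans ?_
    have h1 := PLoc.map_mk (nonvanishing_anti i.unop.le) p.1 p.2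
    exact ((congrArg (PLoc.map (nonvanishing_anti j.unop.le)) h1).trans (PLoc.map_mk ..)).symm

variable {A}

open PStalk

/-- The canonical map from the stalk at `p` of the presheaf `U ↦ S_U⁻¹ A` to `A_p`. -/
def toLocalization (p : PSpec A) :
    PartialRingHom (PStalk (presheaf A) p) (Localization (nonvanishing {p})) :=
  PStalk.desc
    (fun _ hU => PLoc.map (nonvanishing_anti (Set.singleton_subset_iff.2 hU)))
    (fun U V hU hV h s => by
      have key : ∀ s' : Localization (nonvanishing (U : Set (PSpec A))),
          PLoc.map (nonvanishing_anti (Set.singleton_subset_iff.2 hV))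
            (PLoc.map (nonvanishing_anti (show (V : Set (PSpec A)) ⊆ U from h)) s') =
          PLoc.map (nonvanishing_anti (Set.singleton_subset_iff.2 hU)) s' := by
        intro s'
        induction s' using Localization.induction_on with | _ q
        rw [PLoc.map_mk, PLoc.map_mk, PLoc.map_mk]
      exact key s)

/-- The ideal of the elements `a/s` of `A_p` with `a ∈ p`. -/
def locIdeal (p : PSpec A) : PIdeal (Localization (nonvanishing {p})) where
  carrier := {x | ∃ a s, a ∈ p.ideal ∧ x = Localization.mk a s}
  zero_mem' := ⟨0, 1, p.ideal.zero_mem, (Localization.mk_zero _).symm⟩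
  padd_mem' x y h := by
    rintro ⟨a, s, ha, rfl⟩ ⟨b, t, hb, rfl⟩
    obtain ⟨u, c, hc, e⟩ := (PLoc.isSum_iff_graph.1 ⟨h, rfl⟩).of_mk
    exact ⟨c, _, p.ideal.mem_of_isSum hc (p.ideal.mul_mem _ ha) (p.ideal.mul_mem _ hb), e⟩
  mul_mem' x y := by
    rintro ⟨a, s, ha, rfl⟩
    induction x using Localization.induction_on with | _ q
    exact ⟨q.1 * a, q.2 * s, p.ideal.mul_mem _ ha, Localization.mk_mul ..⟩

theorem one_notMem_locIdeal (p : PSpec A) : 1 ∉ locIdeal p := by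
  rintro ⟨a, s, ha, e⟩
  rw [← Localization.mk_one] at e
  obtain ⟨u, hu⟩ := PLoc.mk_eq.1 e
  refine (u * s).2 p rfl ?_
  have : ((u * s : nonvanishing {p}) : A) = u * a := by simpa using hu
  rw [this]
  exact p.ideal.mul_mem _ ha

theorem isUnit_of_notMem (p : PSpec A) (g : PStalk (presheaf A) p)
    (h : toLocalization p g ∉ locIdeal p) : IsUnit g := by
  obtain ⟨U, hU, s, rfl⟩ := exists_germ g
  let s' : Localization (nonvanishing (U : Set (PSpec A))) := s
  obtain ⟨a, t, hs⟩ : ∃ a t, s' = Localization.mk a t := by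
    induction s' using Localization.induction_on with | _ q
    exact ⟨q.1, q.2, rfl⟩
  have ha : a ∉ p.ideal := fun ha => h ⟨a, ⟨t, nonvanishing_anti
    (Set.singleton_subset_iff.2 hU) t.2⟩, ha, by
      refine Eq.trans (congrArg (PLoc.map (nonvanishing_anti
        (Set.singleton_subset_iff.2 hU))) hs) ?_
      rw [PLoc.map_mk]⟩
  let V : Opens (TopCat.of (PSpec A)) := ⟨basicOpen a, isOpen_basicOpen a⟩
  have hp : p ∈ U ⊓ V := ⟨hU, ha⟩
  have hle : nonvanishing (U : Set (PSpec A)) ≤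
      nonvanishing ((U ⊓ V : Opens (TopCat.of (PSpec A))) : Set (PSpec A)) :=
    nonvanishing_anti (fun _ h => h.1)
  let t' : nonvanishing ((U ⊓ V : Opens (TopCat.of (PSpec A))) : Set (PSpec A)) := ⟨t, hle t.2⟩
  let a' : nonvanishing ((U ⊓ V : Opens (TopCat.of (PSpec A))) : Set (PSpec A)) :=
    ⟨a, fun q hq => hq.2⟩
  let r : (presheaf A).obj (op (U ⊓ V)) := Localization.mk (t : A) a'
  refine IsUnit.of_mul_eq_one (germ (presheaf A) hp r) ?_
  rw [← germ_res inf_le_left hp s, ← germ_mul, ← germ_one hp]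
  congr 1
  change PLoc.map hle s' * Localization.mk (t : A) a' = 1
  rw [hs, PLoc.map_mk, Localization.mk_mul, ← Localization.mk_one]
  exact PLoc.mk_eq.2 ⟨1, by simp [a', mul_comm]⟩

theorem isLocal_stalk (p : PSpec A) :
    IsLocalPRing (PStalk (PSheafify (presheaf A)) (p : TopCat.of (PSpec A))) := by
  let f := (toLocalization p).comp (PSheafify.stalkEval (presheaf A) p)
  refine IsLocalPRing.of_units (PIdeal.comap f (locIdeal p)) ?_ ?_
  · rw [PIdeal.mem_comap, map_one]
    exact one_notMem_locIdeal p
  · intro g hg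
    exact PSheafify.isUnit_of_stalkEval _ _ _ (isUnit_of_notMem _ _ hg)

end PSpec

/-- `Spec A`: the prime spectrum with the Zariski topology and the sheafification of
`U ↦ S_U⁻¹ A`. -/
def LocallyPRingedSpace.Spec (A : PRing.{u}) : LocallyPRingedSpace.{u} where
  carrier := TopCat.of (PSpec A)
  presheaf := PSheafify (PSpec.presheaf A)
  IsSheaf := PSheafify.isSheaf _
  isLocal p := PSpec.isLocal_stalk p

end

/-!
Let `B` be the partial ring of global sections of `Spec A` and `ψ : A → B` the canonical
homomorphism. It becomes an isomorphism after inverting `A ∖ p`, for each prime ideal `p` of `A`: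
evaluation at `p` is a homomorphism `B → A_p` under `A`, and each `b ∈ B` satisfies
`ψ s * b = ψ a` for some `s ∉ p` and `a` (`PSpec.isIsoAtPrimes_toGlobal`).

To find `s` and `a` for a global section `b`, write `b = a/s` near `p`. The elements `h` such that
`s ^ (N + 1) * b = s ^ N * a` on `D(h)` for some `N` form an ideal (`PSpec.clearingIdeal`), which
plays the role of the quasi-compactness of `Spec A`. That it lies in no prime ideal, and so contains
`1`, follows by writing `b` as a fraction near each prime ideal and comparing it with `a/s`. In the
comparison, the ideal of all `u` with `u * x = u * y` (`PIdeal.equalizer`) replaces the annihilator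
of the difference `x - y`, which is not available in a partial ring. The existence of prime ideals
is `PIdeal.exists_prime_disjoint`.

Any `ψ : A → B` which is an isomorphism after localization at each prime ideal of `A` induces an
isomorphism of spectra (`LocallyPRingedSpace.specIso`). Clearing denominators shows that `q ↦ ψ⁻¹ q`
is injective and open; the prime ideal over `p` is the set of all `b` whose value in `A_p` lies in
the maximal ideal. The homomorphism `A_{ψ⁻¹ q} → B_q` has a left inverse, given by evaluation. The
sections of a structure sheaf are the families of elements of the localizations which are locally
fractions (`PSpec.isLocallyFrac_val`, `PSpec.IsLocallyFrac.exists_section`), so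
`PSpec.sectionMap` identifies the structure sheaves.
-/

open PartialRing

noncomputable section

/-! ### Prime ideals -/

namespace PIdeal

variable {A : Type u} [PartialRing A]

/-- The ideal quotient `(I : b)`. -/
def colon (I : PIdeal A) (b : A) : PIdeal A where
  carrier := {x | x * b ∈ I}
  zero_mem' := by simpa using I.zero_mem
  padd_mem' x y h hx hy := I.mem_of_isSum (IsSum.mul ⟨h, rfl⟩ b) hx hy
  mul_mem' a x hx := by
    simp only [Set.mem_ofPred_eq, mul_assoc]
    exact I.mul_mem a hx

theorem mem_colon {I : PIdeal A} {b x : A} : x ∈ I.colon b ↔ x * b ∈ I := Iff.rfl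

theorem le_colon (I : PIdeal A) (b : A) : (I : Set A) ⊆ I.colon b := fun x hx => by
  rw [SetLike.mem_coe, mem_colon, mul_comm]
  exact I.mul_mem b hx

/-- The ideal of the elements which equalize `x` and `y`. It takes the place of the annihilator
of `x - y`. -/
def equalizer (x y : A) : PIdeal A where
  carrier := {u | u * x = u * y}
  zero_mem' := by simp
  padd_mem' u v h hu hv := by
    have h1 : IsSum (u * x) (v * x) _ := IsSum.mul ⟨h, rfl⟩ x
    have h2 : IsSum (u * y) (v * y) _ := IsSum.mul ⟨h, rfl⟩ y
    rw [Set.mem_ofPred_eq] at hu hv ⊢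
    rw [hu, hv] at h1
    exact h1.unique h2
  mul_mem' a u hu := by
    rw [Set.mem_ofPred_eq] at hu ⊢
    rw [mul_assoc, hu, mul_assoc]

theorem mem_equalizer {x y u : A} : u ∈ equalizer x y ↔ u * x = u * y := Iff.rfl

/-- An ideal which is disjoint from a multiplicative set `S` is contained in a prime ideal which
is disjoint from `S`. -/
theorem exists_prime_disjoint (I : PIdeal A) (S : Submonoid A) (h : ∀ s ∈ S, s ∉ I) :
    ∃ M : PIdeal A, M.IsPrime ∧ (I : Set A) ⊆ M ∧ ∀ s ∈ S, s ∉ M := by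
  obtain ⟨m, hIm, hm⟩ := zorn_subset_nonempty
    {J : Set A | ∃ M : PIdeal A, (M : Set A) = J ∧ ∀ s ∈ S, s ∉ M} (by
      intro c hc hchain ⟨J₀, hJ₀⟩
      refine ⟨⋃₀ c, ⟨⟨⋃₀ c, ?_, ?_, ?_⟩, rfl, ?_⟩, fun s hs => Set.subset_sUnion_of_mem hs⟩
      · obtain ⟨M, rfl, -⟩ := hc hJ₀
        exact ⟨_, hJ₀, M.zero_mem⟩
      · rintro a b hab ⟨J, hJ, ha⟩ ⟨K, hK, hb⟩
        obtain ⟨L, hL, hJL, hKL⟩ : ∃ L ∈ c, J ⊆ L ∧ K ⊆ L :=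
          (hchain.total hJ hK).elim (fun h => ⟨K, hK, h, le_rfl⟩) (fun h => ⟨J, hJ, le_rfl, h⟩)
        obtain ⟨M, rfl, -⟩ := hc hL
        exact ⟨_, hL, M.padd_mem' a b hab (hJL ha) (hKL hb)⟩
      · rintro a x ⟨J, hJ, hx⟩
        obtain ⟨M, rfl, -⟩ := hc hJ
        exact ⟨_, hJ, M.mul_mem a hx⟩
      · rintro s hs ⟨J, hJ, hsJ⟩
        obtain ⟨M, rfl, hM⟩ := hc hJ
        exact hM s hs hsJ) I ⟨I, rfl, h⟩
  obtain ⟨⟨M, rfl, hM⟩, hmax⟩ := hm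
  have key : ∀ b, (∀ s ∈ S, s ∉ M.colon b) → (M.colon b : Set A) ⊆ M := fun b hb =>
    hmax ⟨_, rfl, hb⟩ (M.le_colon b)
  refine ⟨M, ⟨fun h => hM 1 S.one_mem (h ▸ Set.mem_univ (1 : A) :), fun a b hab => ?_⟩, hIm, hM⟩
  by_contra hc
  obtain ⟨ha, hb⟩ := not_or.1 hc
  refine ha (key b (fun s hs hsb => hb (key s (fun t ht hts => ?_) ?_)) hab)
  · exact hM (t * s) (S.mul_mem ht hs) hts
  · rw [SetLike.mem_coe, mem_colon, mul_comm]
    exact hsb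

end PIdeal

namespace PSpec

variable {A : Type u} [PartialRing A]

/-- If no point of `D(f)` contains `I`, then a power of `f` lies in `I`. -/
theorem exists_pow_mem (I : PIdeal A) (f : A)
    (h : ∀ p : PSpec A, f ∉ p.ideal → ∃ a ∈ I, a ∉ p.ideal) : ∃ n : ℕ, f ^ n ∈ I := by
  by_contra! hc
  obtain ⟨M, hM, hIM, hf⟩ := I.exists_prime_disjoint (Submonoid.powers f)
    (by rintro _ ⟨n, rfl⟩; exact hc n)
  obtain ⟨a, ha, ha'⟩ := h ⟨M, hM⟩ (hf f (Submonoid.mem_powers f))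
  exact ha' (hIM ha)

theorem one_mem_of_forall (I : PIdeal A) (h : ∀ p : PSpec A, ∃ a ∈ I, a ∉ p.ideal) :
    (1 : A) ∈ I := by
  obtain ⟨n, hn⟩ := exists_pow_mem I 1 (fun p _ => h p)
  rwa [one_pow] at hn

theorem mul_notMem {p : PSpec A} {a b : A} (ha : a ∉ p.ideal) (hb : b ∉ p.ideal) :
    a * b ∉ p.ideal := fun h => (p.isPrime.mem_or_mem _ _ h).elim ha hb

theorem left_notMem {p : PSpec A} {a b : A} (h : a * b ∉ p.ideal) : a ∉ p.ideal := fun ha =>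
  h (mul_comm a b ▸ p.ideal.mul_mem b ha)

theorem right_notMem {p : PSpec A} {a b : A} (h : a * b ∉ p.ideal) : b ∉ p.ideal := fun hb =>
  h (p.ideal.mul_mem a hb)

theorem mul_mem_iff {p : PSpec A} {a b : A} (ha : a ∉ p.ideal) :
    a * b ∈ p.ideal ↔ b ∈ p.ideal :=
  ⟨fun h => (p.isPrime.mem_or_mem _ _ h).resolve_left ha, fun h => p.ideal.mul_mem a h⟩

/-- The inverse image of a prime ideal. -/
def comap {B : Type u} [PartialRing B] (f : PartialRingHom A B) (q : PSpec B) : PSpec A where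
  ideal := PIdeal.comap f q.ideal
  isPrime := by
    refine ⟨fun h => ?_, fun a b h => ?_⟩
    · have h1 : (1 : A) ∈ PIdeal.comap f q.ideal := (h ▸ Set.mem_univ (1 : A) :)
      rw [PIdeal.mem_comap, map_one] at h1
      exact PIdeal.one_notMem q.isPrime.ne_univ h1
    · rw [PIdeal.mem_comap, map_mul] at h
      exact q.isPrime.mem_or_mem _ _ h

@[simp]
theorem mem_comap {B : Type u} [PartialRing B] {f : PartialRingHom A B} {q : PSpec B} {a : A} :
    a ∈ (comap f q).ideal ↔ f a ∈ q.ideal := Iff.rfl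

end PSpec

/-! ### Localizations -/

theorem PartialRing.IsSum.of_mul_isUnit {A : Type u} [PartialRing A] {a b c d : A}
    (hd : IsUnit d) (h : IsSum (a * d) (b * d) (c * d)) : IsSum a b c := by
  obtain ⟨e, he⟩ := hd.exists_right_inv
  simpa [mul_assoc, he] using h.mul e

namespace PLoc

variable {A B : Type u} [PartialRing A] [PartialRing B] {S : Submonoid A}

variable (S) in
/-- The canonical homomorphism `A → S⁻¹A`, `a ↦ a/1`. -/
def of : PartialRingHom A (Localization S) :=
  PartialRingHom.mk' (fun a => Localization.mk a 1) (Localization.mk_zero 1) Localization.mk_one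
    (fun a b => by rw [Localization.mk_mul, one_mul])
    (fun a b c h => isSum_iff.2 ⟨a, b, c, 1, h, rfl, rfl, rfl⟩)

theorem of_apply (a : A) : of S a = Localization.mk a 1 := rfl

theorem mk_mul_of (a : A) (s : S) : Localization.mk a s * of S s = of S a := by
  rw [of_apply, of_apply, Localization.mk_mul]
  exact mk_eq.2 ⟨1, by simp [mul_comm]⟩

theorem isUnit_of {s : A} (hs : s ∈ S) : IsUnit (of S s) := by
  refine IsUnit.of_mul_eq_one (Localization.mk 1 ⟨s, hs⟩) ?_
  rw [mul_comm]
  exact (mk_mul_of 1 ⟨s, hs⟩).trans (map_one _)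

theorem eq_mk_of_mul_eq {x : Localization S} {a : A} {s : S} (h : x * of S s = of S a) :
    x = Localization.mk a s :=
  (isUnit_of s.2).mul_right_cancel (h.trans (mk_mul_of a s).symm)

theorem exists_mul_eq (x : Localization S) : ∃ a, ∃ s ∈ S, x * of S s = of S a := by
  induction x using Localization.induction_on with | _ p
  exact ⟨p.1, p.2, p.2.2, mk_mul_of p.1 p.2⟩

theorem of_eq_of {a b : A} : of S a = of S b ↔ ∃ s ∈ S, s * a = s * b := by
  rw [of_apply, of_apply, mk_eq]
  simp

/-- The homomorphism `S⁻¹A → B` induced by a homomorphism `A → B` which maps `S` to units. -/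
def lift (f : PartialRingHom A B) (hf : ∀ s : S, IsUnit (f s)) :
    PartialRingHom (Localization S) B :=
  let g : Localization S →* B := (Localization.monoidOf S).lift (g := (f : A →* B)) hf
  have hg : ∀ a, g (of S a) = f a := fun a => by
    change (Localization.monoidOf S).lift _ (Localization.mk a 1) = f a
    rw [Localization.mk_one_eq_monoidOf_mk]
    exact (Localization.monoidOf S).lift_eq (g := (f : A →* B)) hf a
  PartialRingHom.mk' g
    (by rw [← map_zero (of S), hg, map_zero]) (map_one g) (map_mul g)
    (fun x y z h => by
      obtain ⟨a, b, c, s, h', rfl, rfl, rfl⟩ := isSum_iff.1 h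
      refine IsSum.of_mul_isUnit (hf s) ?_
      rw [← hg, ← map_mul, ← map_mul, ← map_mul, mk_mul_of, mk_mul_of, mk_mul_of, hg, hg, hg]
      exact f.map_isSum h')

@[simp]
theorem lift_of (f : PartialRingHom A B) (hf : ∀ s : S, IsUnit (f s)) (a : A) :
    lift f hf (of S a) = f a := by
  change (Localization.monoidOf S).lift (g := (f : A →* B)) hf (Localization.mk a 1) = f a
  rw [Localization.mk_one_eq_monoidOf_mk]
  exact (Localization.monoidOf S).lift_eq (g := (f : A →* B)) hf a

/-- Homomorphisms out of `S⁻¹A` are determined by their restrictions to `A`. -/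
theorem hom_ext {f g : PartialRingHom (Localization S) B} (h : ∀ a, f (of S a) = g (of S a)) :
    f = g := by
  refine PartialRingHom.ext fun x => ?_
  obtain ⟨a, s, hs, e⟩ := exists_mul_eq x
  refine ((isUnit_of hs).map f).mul_right_cancel ?_
  rw [← map_mul, e, h, h, ← map_mul, e]

end PLoc

namespace PSpec

variable {A : Type u} [PartialRing A]

/-- The localization `A_p` of `A` at the prime ideal `p`. -/
abbrev Loc (p : PSpec A) : Type u := Localization (nonvanishing {p})

/-- The canonical homomorphism `A → A_p`. -/
abbrev toLoc (p : PSpec A) : PartialRingHom A p.Loc := PLoc.of (nonvanishing {p})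

theorem mem_nonvanishing_singleton {p : PSpec A} {a : A} :
    a ∈ nonvanishing {p} ↔ a ∉ p.ideal :=
  ⟨fun h => h p rfl, fun h q hq => by rwa [Set.mem_singleton_iff.1 hq]⟩

theorem isUnit_toLoc {p : PSpec A} {a : A} (h : a ∉ p.ideal) : IsUnit (p.toLoc a) :=
  PLoc.isUnit_of (mem_nonvanishing_singleton.2 h)

theorem toLoc_mem_locIdeal {p : PSpec A} {a : A} : p.toLoc a ∈ locIdeal p ↔ a ∈ p.ideal := by
  refine ⟨fun h => ?_, fun h => ⟨a, 1, h, rfl⟩⟩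
  by_contra ha
  obtain ⟨b, hb⟩ := (isUnit_toLoc ha).exists_left_inv
  exact one_notMem_locIdeal p (hb ▸ (locIdeal p).mul_mem b h)

theorem exists_toLoc {p : PSpec A} (x : p.Loc) :
    ∃ a s, s ∉ p.ideal ∧ x * p.toLoc s = p.toLoc a := by
  obtain ⟨a, s, hs, e⟩ := PLoc.exists_mul_eq x
  exact ⟨a, s, mem_nonvanishing_singleton.1 hs, e⟩

theorem toLoc_eq_toLoc {p : PSpec A} {a b : A} :
    p.toLoc a = p.toLoc b ↔ ∃ s ∉ p.ideal, s * a = s * b := by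
  rw [PLoc.of_eq_of]
  simp only [mem_nonvanishing_singleton]

theorem isUnit_of_notMem_locIdeal {p : PSpec A} {x : p.Loc} (h : x ∉ locIdeal p) : IsUnit x := by
  obtain ⟨a, s, hs, e⟩ := exists_toLoc x
  have ha : a ∉ p.ideal := fun ha => h ((isUnit_toLoc hs).exists_right_inv.elim fun t ht => by
    have := (locIdeal p).mul_mem t (toLoc_mem_locIdeal.2 ha)
    rwa [← e, mul_comm, mul_assoc, ht, mul_one] at this)
  exact isUnit_of_mul_isUnit_left (e ▸ isUnit_toLoc ha)

end PSpec

/-! ### Sections of the structure sheaf -/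

namespace PSpec

open PStalk

variable {A : Type u} [PartialRing A]

/-- The open set `D(a)`. -/
def opensD (a : A) : Opens (TopCat.of (PSpec A)) := ⟨basicOpen a, isOpen_basicOpen a⟩

/-- The fraction `a/d` as a section of the presheaf `U ↦ S_U⁻¹ A` over an open set `U ⊆ D(d)`. -/
def frac {U : Opens (TopCat.of (PSpec A))} (a d : A) (h : U ≤ opensD d) :
    (presheaf A).obj (op U) :=
  (Localization.mk a ⟨d, fun _ hp => h hp⟩ : Localization (nonvanishing (U : Set (PSpec A))))

theorem exists_frac_eq {U : Opens (TopCat.of (PSpec A))} (s : (presheaf A).obj (op U)) :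
    ∃ a d h, s = frac (U := U) a d h := by
  let s' : Localization (nonvanishing (U : Set (PSpec A))) := s
  obtain ⟨a, t, hs⟩ : ∃ a t, s' = Localization.mk a t := by
    induction s' using Localization.induction_on with | _ q
    exact ⟨q.1, q.2, rfl⟩
  exact ⟨a, t, fun p hp => t.2 p hp, hs⟩

theorem res_frac {U V : Opens (TopCat.of (PSpec A))} (a d : A) (h : U ≤ opensD d) (k : V ≤ U) :
    res (presheaf A) k (frac a d h) = frac a d (k.trans h) :=
  PLoc.map_mk (nonvanishing_anti (show (V : Set (PSpec A)) ⊆ U from k)) a _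

theorem toLocalization_frac {U : Opens (TopCat.of (PSpec A))} {p : PSpec A} (hp : p ∈ U)
    (a d : A) (h : U ≤ opensD d) :
    toLocalization p (germ (presheaf A) hp (frac a d h)) =
      (Localization.mk a ⟨d, mem_nonvanishing_singleton.2 (h hp)⟩ : p.Loc) :=
  PLoc.map_mk (nonvanishing_anti (Set.singleton_subset_iff.2 hp)) a ⟨d, fun _ hq => h hq⟩

/-- Together with `toLocalization_surjective` and `toLocalization_isSum`, this identifies the stalk
at `p` of the presheaf `U ↦ S_U⁻¹ A` with `A_p` as a partial ring. -/
theorem toLocalization_injective (p : PSpec A) : Function.Injective (toLocalization p) := by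
  intro g h e
  obtain ⟨U, hU, s, t, rfl, rfl⟩ := exists_germ₂ g h
  obtain ⟨a, d, ha, rfl⟩ := exists_frac_eq s
  obtain ⟨b, c, hb, rfl⟩ := exists_frac_eq t
  rw [toLocalization_frac, toLocalization_frac] at e
  obtain ⟨⟨u, hu⟩, e⟩ := PLoc.mk_eq.1 e
  refine germ_eq.2 ⟨U ⊓ opensD u, ⟨hU, mem_nonvanishing_singleton.1 hu⟩, inf_le_left,
    inf_le_left, ?_⟩
  rw [res_frac, res_frac]
  exact PLoc.mk_eq.2 ⟨⟨u, fun q hq => hq.2⟩, e⟩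

theorem toLocalization_surjective (p : PSpec A) : Function.Surjective (toLocalization p) := by
  intro x
  obtain ⟨a, d, hd, e⟩ := exists_toLoc x
  have hp : p ∈ opensD d := hd
  refine ⟨germ (presheaf A) hp (frac a d le_rfl), ?_⟩
  rw [toLocalization_frac]
  exact (PLoc.eq_mk_of_mul_eq (s := ⟨d, mem_nonvanishing_singleton.2 hd⟩) e).symm

theorem toLocalization_isSum {p : PSpec A} {g h k : PStalk (presheaf A) p} :
    IsSum (toLocalization p g) (toLocalization p h) (toLocalization p k) ↔ IsSum g h k := by
  refine ⟨fun hs => ?_, (toLocalization p).map_isSum⟩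
  obtain ⟨a, b, c, ⟨d, hd⟩, e, e1, e2, e3⟩ := PLoc.isSum_iff.1 hs
  have hp : p ∈ opensD d := mem_nonvanishing_singleton.1 hd
  have key : ∀ (a : A) (g : PStalk (presheaf A) p),
      toLocalization p g = (Localization.mk a ⟨d, hd⟩ : p.Loc) →
        g = germ (presheaf A) hp (frac a d le_rfl) := fun a g e =>
    toLocalization_injective p (e.trans (toLocalization_frac hp a d le_rfl).symm)
  rw [key a g e1, key b h e2, key c k e3]
  refine germ_isSum hp ?_
  exact PLoc.isSum_iff.2 ⟨a, b, c, _, e, rfl, rfl, rfl⟩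

open PSheafify

variable {U V : Opens (TopCat.of (PSpec A))}

/-- The value in `A_p` of a section of the structure sheaf. -/
def val (s : Sections (presheaf A) U) (p : PSpec A) (hp : p ∈ U) : p.Loc :=
  toLocalization p (s ⟨p, hp⟩)

theorem val_ext {s t : Sections (presheaf A) U} (h : ∀ p hp, val s p hp = val t p hp) : s = t :=
  Sections.ext fun x => toLocalization_injective x.1 (h x.1 x.2)

theorem isSum_iff_val {s t r : Sections (presheaf A) U} :
    IsSum s t r ↔ ∀ p hp, IsSum (val s p hp) (val t p hp) (val r p hp) :=
  Sections.isSum_iff.trans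
    ⟨fun h p hp => toLocalization_isSum.2 (h ⟨p, hp⟩),
      fun h x => toLocalization_isSum.1 (h x.1 x.2)⟩

theorem val_mul (s t : Sections (presheaf A) U) (p : PSpec A) (hp : p ∈ U) :
    val (s * t) p hp = val s p hp * val t p hp := map_mul (toLocalization p) _ _

theorem val_one (p : PSpec A) (hp : p ∈ U) : val (1 : Sections (presheaf A) U) p hp = 1 :=
  map_one (toLocalization p)

theorem val_zero (p : PSpec A) (hp : p ∈ U) : val (0 : Sections (presheaf A) U) p hp = 0 :=
  map_zero (toLocalization p)

theorem val_restrict (h : V ≤ U) (s : Sections (presheaf A) U) (p : PSpec A) (hp : p ∈ V) :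
    val (Sections.restrict h s) p hp = val s p (h hp) := rfl

/-- A family of elements of the localizations `A_p`, `p ∈ U`, is locally a fraction if around
every point of `U` there are `a` and `d` such that its members are equal to `a/d` on `D(d) ∩ U`.
That `D(d)` need not lie in `U` and that the same `d` is the denominator and defines the
neighbourhood is no restriction, as `a/d = (ae)/(de)` on `D(de) = D(d) ∩ D(e)`. -/
def IsLocallyFrac (f : ∀ p : PSpec A, p ∈ U → p.Loc) : Prop :=
  ∀ p ∈ U, ∃ a d : A, d ∉ p.ideal ∧
    ∀ (q : PSpec A) (hq : q ∈ U), d ∉ q.ideal → f q hq * q.toLoc d = q.toLoc a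

theorem exists_opensD_le {p : PSpec A} (hp : p ∈ U) : ∃ a : A, p ∈ opensD a ∧ opensD a ≤ U := by
  have key : ∀ W : Set (PSpec A), IsOpen W → ∀ p ∈ W, ∃ a : A, a ∉ p.ideal ∧ basicOpen a ⊆ W := by
    intro W hW
    induction hW with
    | basic s hs =>
      obtain ⟨a, rfl⟩ := hs
      exact fun p hp => ⟨a, hp, le_rfl⟩
    | univ => exact fun p _ => ⟨1, PIdeal.one_notMem p.isPrime.ne_univ, Set.subset_univ _⟩
    | inter s t _ _ hs ht =>
      rintro p ⟨hps, hpt⟩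
      obtain ⟨a, ha, ha'⟩ := hs p hps
      obtain ⟨b, hb, hb'⟩ := ht p hpt
      exact ⟨a * b, mul_notMem ha hb, fun q hq => ⟨ha' (left_notMem hq), hb' (right_notMem hq)⟩⟩
    | sUnion S _ hS =>
      rintro p ⟨s, hs, hps⟩
      obtain ⟨a, ha, ha'⟩ := hS s hs p hps
      exact ⟨a, ha, ha'.trans (Set.subset_sUnion_of_mem hs)⟩
  exact key U U.2 p hp

theorem isLocallyFrac_val (s : Sections (presheaf A) U) : IsLocallyFrac (val s) := by
  intro p hp
  obtain ⟨V, hV, hVU, t, ht⟩ := s.2 ⟨p, hp⟩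
  obtain ⟨a, d, hd, rfl⟩ := exists_frac_eq t
  obtain ⟨e, he, heV⟩ := exists_opensD_le hV
  refine ⟨a * e, d * e, mul_notMem (hd hV) he, fun q hq hde => ?_⟩
  have hqV : q ∈ V := heV (right_notMem hde)
  have e1 : val s q hq = _ := (congrArg (toLocalization q) (ht ⟨q, hqV⟩)).trans
    (toLocalization_frac hqV a d hd)
  rw [e1, map_mul, map_mul, ← mul_assoc]
  exact congrArg (· * q.toLoc e) (PLoc.mk_mul_of a _)

theorem IsLocallyFrac.exists_section {f : ∀ p : PSpec A, p ∈ U → p.Loc} (hf : IsLocallyFrac f) :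
    ∃ s : Sections (presheaf A) U, ∀ p hp, val s p hp = f p hp := by
  choose g hg using fun x : U => toLocalization_surjective x.1 (f x.1 x.2)
  refine ⟨⟨g, fun x => ?_⟩, fun p hp => hg ⟨p, hp⟩⟩
  obtain ⟨a, d, hd, h⟩ := hf x.1 x.2
  refine ⟨U ⊓ opensD d, ⟨x.2, hd⟩, inf_le_left, frac a d inf_le_right, fun y => ?_⟩
  refine toLocalization_injective y.1 ?_
  refine (hg ⟨y.1, y.2.1⟩).trans (Eq.trans ?_ (toLocalization_frac y.2 a d inf_le_right).symm)
  exact PLoc.eq_mk_of_mul_eq (s := ⟨d, mem_nonvanishing_singleton.2 y.2.2⟩) (h y.1 y.2.1 y.2.2)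

end PSpec

/-! ### Homomorphisms which are isomorphisms after localization -/

/-- A homomorphism `ψ : A → B` which becomes an isomorphism after inverting `A ∖ p`, for each
prime ideal `p` of `A`: there is a homomorphism `B → A_p` under `A`, and every element of `B` is
a fraction `ψ a / ψ s` with `s ∉ p`. -/
structure PartialRingHom.IsIsoAtPrimes {A B : Type u} [PartialRing A] [PartialRing B]
    (ψ : PartialRingHom A B) : Prop where
  exists_eval (p : PSpec A) : ∃ e : PartialRingHom B p.Loc, ∀ a, e (ψ a) = p.toLoc a
  exists_mul_eq (p : PSpec A) (b : B) : ∃ s a, s ∉ p.ideal ∧ ψ s * b = ψ a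

namespace PSpec

variable {A B : Type u} [PartialRing A] [PartialRing B] {ψ : PartialRingHom A B}

theorem comap_injective (h : ψ.IsIsoAtPrimes) : Function.Injective (comap ψ) := by
  have key : ∀ q q' : PSpec B, comap ψ q = comap ψ q' → ∀ b ∈ q.ideal, b ∈ q'.ideal := by
    intro q q' e b hb
    obtain ⟨s, a, hs, hsa⟩ := h.exists_mul_eq (comap ψ q) b
    have ha : a ∈ (comap ψ q).ideal := by
      rw [mem_comap, ← hsa]
      exact q.ideal.mul_mem _ hb
    rw [e] at hs ha
    rw [mem_comap, ← hsa] at ha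
    rw [mem_comap] at hs
    exact (mul_mem_iff hs).1 ha
  intro q q' e
  ext b
  exact ⟨key q q' e b, key q' q e.symm b⟩

/-- The prime ideal over `p` consists of the elements whose value in `A_p` lies in the maximal
ideal. -/
theorem comap_surjective (h : ψ.IsIsoAtPrimes) : Function.Surjective (comap ψ) := by
  intro p
  obtain ⟨e, he⟩ := h.exists_eval p
  have hprime : (PIdeal.comap e (locIdeal p)).IsPrime := by
    refine ⟨fun hu => ?_, fun x y hxy => ?_⟩
    · have h1 : (1 : B) ∈ PIdeal.comap e (locIdeal p) := (hu ▸ Set.mem_univ (1 : B) :)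
      rw [PIdeal.mem_comap, map_one] at h1
      exact one_notMem_locIdeal p h1
    · rw [PIdeal.mem_comap, map_mul] at hxy
      by_contra! hc
      obtain ⟨z, hz⟩ := ((isUnit_of_notMem_locIdeal hc.1).mul
        (isUnit_of_notMem_locIdeal hc.2)).exists_left_inv
      exact one_notMem_locIdeal p (hz ▸ (locIdeal p).mul_mem z hxy)
  refine ⟨⟨_, hprime⟩, ?_⟩
  ext a
  change e (ψ a) ∈ locIdeal p ↔ a ∈ p.ideal
  rw [he, toLoc_mem_locIdeal]

theorem continuous_comap (ψ : PartialRingHom A B) : Continuous (comap ψ) := by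
  refine continuous_generateFrom_iff.2 ?_
  rintro _ ⟨a, rfl⟩
  exact isOpen_basicOpen (ψ a)

theorem isOpenMap_comap (h : ψ.IsIsoAtPrimes) : IsOpenMap (comap ψ) := by
  intro W hW
  refine isOpen_iff_forall_mem_open.2 ?_
  rintro _ ⟨q, hq, rfl⟩
  obtain ⟨b, hb, hbW⟩ := exists_opensD_le (U := ⟨W, hW⟩) hq
  obtain ⟨s, a, hs, hsa⟩ := h.exists_mul_eq (comap ψ q) b
  -- `D(b)` contains the preimage of `D(a)`, as `ψ a = ψ s * b`
  have ha : ψ a ∉ q.ideal := hsa ▸ mul_notMem hs hb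
  refine ⟨basicOpen a, fun p hp => ?_, isOpen_basicOpen _, ha⟩
  obtain ⟨q', rfl⟩ := comap_surjective h p
  exact ⟨q', hbW (right_notMem (a := ψ s) (hsa ▸ hp)), rfl⟩

/-- The homeomorphism `Spec B → Spec A` of a homomorphism which is an isomorphism after
localization at each prime ideal of `A`. -/
def homeoComap (h : ψ.IsIsoAtPrimes) : PSpec B ≃ₜ PSpec A :=
  (Equiv.ofBijective (comap ψ) ⟨comap_injective h, comap_surjective h⟩).toHomeomorphOfContinuousOpen
    (continuous_comap ψ) (isOpenMap_comap h)

/-- The homomorphism `A_{ψ⁻¹ q} → B_q`. -/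
def mapLoc (ψ : PartialRingHom A B) (q : PSpec B) : PartialRingHom (comap ψ q).Loc q.Loc :=
  PLoc.lift (q.toLoc.comp ψ) (fun s => isUnit_toLoc (a := ψ s)
    (mem_nonvanishing_singleton (p := comap ψ q).1 s.2))

@[simp]
theorem mapLoc_toLoc (q : PSpec B) (a : A) :
    mapLoc ψ q ((comap ψ q).toLoc a) = q.toLoc (ψ a) := PLoc.lift_of ..

/-- Evaluation `B → A_p` at `p = ψ⁻¹ q` extends to `B_q` and gives a left inverse of
`A_p → B_q`. -/
theorem exists_mapLoc_leftInverse (h : ψ.IsIsoAtPrimes) (q : PSpec B) :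
    ∃ r : PartialRingHom q.Loc (comap ψ q).Loc, ∀ x, r (mapLoc ψ q x) = x := by
  obtain ⟨e, he⟩ := h.exists_eval (comap ψ q)
  have hu : ∀ w : nonvanishing {q}, IsUnit (e w) := by
    rintro ⟨w, hw⟩
    obtain ⟨s, a, hs, hsa⟩ := h.exists_mul_eq (comap ψ q) w
    have ha : a ∉ (comap ψ q).ideal := by
      rw [mem_comap, ← hsa]
      exact mul_notMem hs (mem_nonvanishing_singleton.1 hw)
    refine isUnit_of_mul_isUnit_right (x := e (ψ s)) ?_
    rw [← map_mul, hsa, he]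
    exact isUnit_toLoc ha
  refine ⟨PLoc.lift e hu, fun x => ?_⟩
  have key : (PLoc.lift e hu).comp (mapLoc ψ q) = PartialRingHom.id _ := PLoc.hom_ext fun a => by
    rw [PartialRingHom.comp_apply, mapLoc_toLoc, PLoc.lift_of, he, PartialRingHom.id_apply]
  exact congrArg (fun f : PartialRingHom _ _ => f x) key

theorem mapLoc_injective (h : ψ.IsIsoAtPrimes) (q : PSpec B) :
    Function.Injective (mapLoc ψ q) :=
  (exists_mapLoc_leftInverse h q).elim fun _ hr => Function.LeftInverse.injective hr

theorem isSum_of_mapLoc (h : ψ.IsIsoAtPrimes) {q : PSpec B} {x y z : (comap ψ q).Loc}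
    (hs : IsSum (mapLoc ψ q x) (mapLoc ψ q y) (mapLoc ψ q z)) : IsSum x y z := by
  obtain ⟨r, hr⟩ := exists_mapLoc_leftInverse h q
  simpa [hr] using r.map_isSum hs

/-! ### Comparison of structure sheaves -/

open PSheafify

variable (ψ) in
/-- The inverse image in `Spec B` of an open subset of `Spec A`. -/
def preimage (U : Opens (TopCat.of (PSpec A))) : Opens (TopCat.of (PSpec B)) :=
  ⟨comap ψ ⁻¹' (U : Set (PSpec A)), U.2.preimage (continuous_comap ψ)⟩

variable {U V : Opens (TopCat.of (PSpec A))}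

theorem mem_preimage {q : PSpec B} : q ∈ preimage ψ U ↔ comap ψ q ∈ U := Iff.rfl

theorem exists_sectionMap (ψ : PartialRingHom A B) (s : Sections (presheaf A) U) :
    ∃ t : Sections (presheaf B) (preimage ψ U),
      ∀ q hq, val t q hq = mapLoc ψ q (val s (comap ψ q) (mem_preimage.1 hq)) := by
  refine IsLocallyFrac.exists_section (fun q hq => ?_)
  obtain ⟨a, d, hd, h⟩ := isLocallyFrac_val s (comap ψ q) hq
  refine ⟨ψ a, ψ d, hd, fun q' hq' hd' => ?_⟩
  rw [← mapLoc_toLoc, ← map_mul, h _ (mem_preimage.1 hq') hd', mapLoc_toLoc]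

/-- The homomorphism `O_{Spec A}(U) → O_{Spec B}(φ⁻¹ U)`, where `φ : Spec B → Spec A` is the map
given by `ψ`. -/
def sectionMap (ψ : PartialRingHom A B) (U : Opens (TopCat.of (PSpec A))) :
    PartialRingHom (Sections (presheaf A) U) (Sections (presheaf B) (preimage ψ U)) :=
  have hval := fun s : Sections (presheaf A) U => (exists_sectionMap ψ s).choose_spec
  PartialRingHom.mk' (fun s => (exists_sectionMap ψ s).choose)
    (val_ext fun q hq => by rw [hval, val_zero, val_zero, map_zero])
    (val_ext fun q hq => by rw [hval, val_one, val_one, map_one])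
    (fun s t => val_ext fun q hq => by rw [hval, val_mul, val_mul, hval, hval, map_mul])
    (fun s t r h => isSum_iff_val.2 fun q hq => by
      rw [hval, hval, hval]
      exact (mapLoc ψ q).map_isSum (isSum_iff_val.1 h _ _))

theorem val_sectionMap (s : Sections (presheaf A) U) (q : PSpec B) (hq : q ∈ preimage ψ U) :
    val (sectionMap ψ U s) q hq = mapLoc ψ q (val s (comap ψ q) (mem_preimage.1 hq)) :=
  (exists_sectionMap ψ s).choose_spec q hq

theorem sectionMap_restrict (h : V ≤ U) (s : Sections (presheaf A) U) :
    sectionMap ψ V (Sections.restrict h s) =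
      Sections.restrict (V := preimage ψ V) (fun _ hq => mem_preimage.2 (h (mem_preimage.1 hq)))
        (sectionMap ψ U s) :=
  val_ext fun q hq => by rw [val_sectionMap, val_restrict, val_restrict, val_sectionMap]

theorem isSum_of_sectionMap (h : ψ.IsIsoAtPrimes) {s t r : Sections (presheaf A) U}
    (hs : IsSum (sectionMap ψ U s) (sectionMap ψ U t) (sectionMap ψ U r)) : IsSum s t r := by
  refine isSum_iff_val.2 fun p hp => ?_
  obtain ⟨q, rfl⟩ := comap_surjective h p
  have := isSum_iff_val.1 hs q (mem_preimage.2 hp)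
  simp only [val_sectionMap] at this
  exact isSum_of_mapLoc h this

theorem sectionMap_injective (h : ψ.IsIsoAtPrimes) : Function.Injective (sectionMap ψ U) := by
  intro s t e
  refine val_ext fun p hp => ?_
  obtain ⟨q, rfl⟩ := comap_surjective h p
  refine mapLoc_injective h q ?_
  rw [← val_sectionMap s q (mem_preimage.2 hp), ← val_sectionMap t q (mem_preimage.2 hp), e]

/-- Sections over `φ⁻¹ U` are locally given by fractions with numerators and denominators
in `A`. -/
theorem exists_frac_preimage (h : ψ.IsIsoAtPrimes) (t : Sections (presheaf B) (preimage ψ U))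
    (p : PSpec A) (hp : p ∈ U) : ∃ a d, d ∉ p.ideal ∧ ∀ q hq, d ∉ (comap ψ q).ideal →
      val t q hq * q.toLoc (ψ d) = q.toLoc (ψ a) := by
  obtain ⟨q, rfl⟩ := comap_surjective h p
  obtain ⟨b, w, hw, ht⟩ := isLocallyFrac_val t q (mem_preimage.2 hp)
  obtain ⟨x, a, hx, hxa⟩ := h.exists_mul_eq (comap ψ q) b
  obtain ⟨y, d, hy, hyd⟩ := h.exists_mul_eq (comap ψ q) w
  have hd : d ∉ (comap ψ q).ideal := by
    rw [mem_comap, ← hyd]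
    exact mul_notMem hy hw
  refine ⟨y * a, x * d, mul_notMem hx hd, fun q' hq' hq'd => ?_⟩
  have hw' : w ∉ q'.ideal := by
    rw [mem_comap, map_mul, ← hyd] at hq'd
    exact right_notMem (right_notMem hq'd)
  rw [map_mul ψ, map_mul ψ, ← hxa, ← hyd]
  simp only [map_mul]
  rw [← ht q' hq' hw']
  ac_rfl

theorem sectionMap_surjective (h : ψ.IsIsoAtPrimes) : Function.Surjective (sectionMap ψ U) := by
  intro t
  choose a d hd ht using exists_frac_preimage h t
  have hval : ∀ q (hq : comap ψ q ∈ U), mapLoc ψ q (Localization.mk (a _ hq)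
      ⟨d _ hq, mem_nonvanishing_singleton.2 (hd _ hq)⟩) = val t q (mem_preimage.2 hq) := by
    intro q hq
    refine (isUnit_toLoc (p := q) (a := ψ (d _ hq)) (hd _ hq)).mul_right_cancel ?_
    rw [ht _ _ _ _ (hd _ hq), ← mapLoc_toLoc, ← map_mul, ← mapLoc_toLoc]
    exact congrArg _ (PLoc.mk_mul_of _ _)
  obtain ⟨s, hs⟩ := IsLocallyFrac.exists_section (U := U) (f := fun p hp => Localization.mk (a p hp)
      ⟨d p hp, mem_nonvanishing_singleton.2 (hd p hp)⟩) (fun p hp => by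
    refine ⟨a p hp, d p hp, hd p hp, fun p' hp' hd' => ?_⟩
    obtain ⟨q, rfl⟩ := comap_surjective h p'
    refine mapLoc_injective h q ?_
    rw [map_mul, hval, mapLoc_toLoc, mapLoc_toLoc]
    exact ht p hp q (mem_preimage.2 hp') hd')
  exact ⟨s, val_ext fun q hq => by rw [val_sectionMap, hs, hval]⟩

end PSpec

/-! ### The partial ring of global sections -/

namespace PSpec

open PStalk PSheafify

variable (A : Type u) [PartialRing A]

/-- The canonical homomorphism from `A` to the partial ring of global sections of `Spec A`. -/
def toGlobal : PartialRingHom A (Sections (presheaf A) ⊤) :=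
  have hval : ∀ a p hp, val (Sections.ofSection (frac a 1 fun p _ =>
      PIdeal.one_notMem p.isPrime.ne_univ) : Sections (presheaf A) ⊤) p hp = p.toLoc a :=
    fun a _ hp => toLocalization_frac hp a 1 _
  PartialRingHom.mk' (fun a => Sections.ofSection (frac a 1 fun p _ =>
      PIdeal.one_notMem p.isPrime.ne_univ))
    (val_ext fun p hp => by rw [hval, val_zero, map_zero])
    (val_ext fun p hp => by rw [hval, val_one, map_one])
    (fun a b => val_ext fun p hp => by rw [val_mul, hval, hval, hval, map_mul])
    (fun a b c h => isSum_iff_val.2 fun p hp => by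
      rw [hval, hval, hval]
      exact p.toLoc.map_isSum h)

variable {A}

@[simp]
theorem val_toGlobal (a : A) (p : PSpec A) (hp : p ∈ (⊤ : Opens (TopCat.of (PSpec A)))) :
    val (toGlobal A a) p hp = p.toLoc a := toLocalization_frac hp a 1 _

/-- For a family `f` of elements of the localizations, the ideal of the elements `h` such that
for some `N` the equation `s ^ (N + 1) * f = s ^ N * a` holds on `D(h)`. Closure under addition
holds because `D(h + k) ⊆ D(h) ∪ D(k)`. -/
def clearingIdeal (f : ∀ p : PSpec A, p.Loc) (a s : A) : PIdeal A where
  carrier := {h | ∃ N : ℕ, ∀ p : PSpec A, h ∉ p.ideal →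
    p.toLoc (s ^ (N + 1)) * f p = p.toLoc (s ^ N * a)}
  zero_mem' := ⟨0, fun p hp => (hp p.ideal.zero_mem).elim⟩
  padd_mem' h k hk := by
    rintro ⟨N, hN⟩ ⟨M, hM⟩
    have aux : ∀ (p : PSpec A) (n m : ℕ),
        p.toLoc (s ^ (n + 1)) * f p = p.toLoc (s ^ n * a) →
          p.toLoc (s ^ (m + n + 1)) * f p = p.toLoc (s ^ (m + n) * a) := by
      intro p n m e
      rw [add_assoc, pow_add, map_mul, mul_assoc, e, ← map_mul, pow_add, mul_assoc]
    refine ⟨M + N, fun p hp => ?_⟩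
    by_cases hh : h ∈ p.ideal
    · have hk' : k ∉ p.ideal := fun hk' => hp (p.ideal.padd_mem' h k hk hh hk')
      rw [add_comm M N]
      exact aux p M N (hM p hk')
    · exact aux p N M (hN p hh)
  mul_mem' b h := fun ⟨N, hN⟩ => ⟨N, fun p hp => hN p (right_notMem hp)⟩

/-- Every global section of `Spec A` is, for every prime ideal `p`, a fraction `a/s` with `a ∈ A`
and `s ∈ A ∖ p`, as an equation of global sections. -/
theorem exists_toGlobal_mul_eq (p : PSpec A) (b : Sections (presheaf A) ⊤) :
    ∃ s a, s ∉ p.ideal ∧ toGlobal A s * b = toGlobal A a := by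
  obtain ⟨a, s, hs, hb⟩ := isLocallyFrac_val b p trivial
  obtain ⟨N, hN⟩ := one_mem_of_forall (clearingIdeal (fun p => val b p trivial) a s) (by
    intro q
    obtain ⟨c, t, ht, hbt⟩ := isLocallyFrac_val b q trivial
    -- `b = a/s` on `D(s)` and `b = c/t` on `D(t)`, so `a * t` and `s * c` agree on `D(s * t)`
    obtain ⟨n, hn⟩ := exists_pow_mem (PIdeal.equalizer (a * t) (s * c)) (s * t) (by
      intro r hr
      have e : r.toLoc (a * t) = r.toLoc (s * c) := by
        rw [map_mul, map_mul, ← hb r trivial (left_notMem hr),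
          ← hbt r trivial (right_notMem hr)]
        ac_rfl
      obtain ⟨u, hu, e⟩ := toLoc_eq_toLoc.1 e
      exact ⟨u, e, hu⟩)
    refine ⟨t, ⟨n, fun r hr => ?_⟩, ht⟩
    refine ((isUnit_toLoc hr).pow (n + 1)).mul_right_cancel ?_
    have e := congrArg r.toLoc (PIdeal.mem_equalizer.1 hn)
    have e' := hbt r trivial hr
    simp only [map_mul, map_pow] at e ⊢
    rw [← e'] at e
    calc r.toLoc s ^ (n + 1) * val b r trivial * r.toLoc t ^ (n + 1)
        = (r.toLoc s * r.toLoc t) ^ n * (r.toLoc s * (val b r trivial * r.toLoc t)) := by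
          rw [mul_pow, pow_succ, pow_succ]
          ac_rfl
      _ = (r.toLoc s * r.toLoc t) ^ n * (r.toLoc a * r.toLoc t) := e.symm
      _ = _ := by
          rw [mul_pow, pow_succ]
          ac_rfl)
  refine ⟨s ^ (N + 1), s ^ N * a, fun h => ?_, val_ext fun q hq => ?_⟩
  · have hu := isUnit_toLoc hs
    have := (hu.pow (N + 1)).exists_left_inv
    rw [← map_pow] at this
    obtain ⟨x, hx⟩ := this
    exact one_notMem_locIdeal p (hx ▸ (locIdeal p).mul_mem x (toLoc_mem_locIdeal.2 h))
  · rw [val_mul, val_toGlobal, val_toGlobal]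
    exact hN q (PIdeal.one_notMem q.isPrime.ne_univ)

theorem isIsoAtPrimes_toGlobal : (toGlobal A).IsIsoAtPrimes where
  exists_eval p := ⟨PartialRingHom.mk' (fun b => val b p trivial) (val_zero (U := ⊤) p trivial)
    (val_one (U := ⊤) p trivial) (fun s t => val_mul s t p trivial)
    (fun _ _ _ h => isSum_iff_val.1 h p trivial), fun a => val_toGlobal a p trivial⟩
  exists_mul_eq := exists_toGlobal_mul_eq

end PSpec

/-! ### Isomorphisms of locally partial-ringed spaces -/

namespace PRing

/-- A bijective homomorphism which reflects sums is an isomorphism. -/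
def isoOfBijective {A B : PRing.{u}} (f : PartialRingHom A B) (hf : Function.Bijective f)
    (hs : ∀ {a b c : A}, IsSum (f a) (f b) (f c) → IsSum a b c) : A ≅ B :=
  let e := Equiv.ofBijective f hf
  have he : ∀ b, f (e.symm b) = b := e.apply_symm_apply
  { hom := f
    inv := PartialRingHom.mk' e.symm
      (hf.1 (by rw [he, map_zero])) (hf.1 (by rw [he, map_one]))
      (fun a b => hf.1 (by rw [map_mul f, he, he, he]))
      (fun a b c h => hs (by rwa [he, he, he]))
    hom_inv_id := PartialRingHom.ext e.symm_apply_apply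
    inv_hom_id := PartialRingHom.ext e.apply_symm_apply }

end PRing

theorem IsLocalPRing.isUnit_of_notMem {A : Type u} [PartialRing A] (h : IsLocalPRing A)
    {M : PIdeal A} (h1 : (1 : A) ∉ M) (hM : ∀ a, a ∉ M → IsUnit a) {a : A}
    (ha : a ∉ h.maximalIdeal) : IsUnit a := by
  have hmax : M.IsMaximal := by
    refine ⟨fun hu => h1 (hu ▸ Set.mem_univ (1 : A) :), fun J hJ hMJ => ?_⟩
    refine SetLike.coe_injective (Set.Subset.antisymm (fun b hb => ?_) hMJ)
    by_contra hc
    obtain ⟨d, hd⟩ := (hM b hc).exists_left_inv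
    exact PIdeal.one_notMem hJ (hd ▸ J.mul_mem d hb)
  exact hM a (h.eq_maximalIdeal hmax ▸ ha)

namespace LocallyPRingedSpace

theorem stalkMap_comp {X Y Z : PresheafedSpace PRing.{u}} (f : X ⟶ Y) (g : Y ⟶ Z) (x : X) :
    stalkMap (f ≫ g) x = (stalkMap f x).comp (stalkMap g (f.base x)) := by
  ext a
  obtain ⟨U, hU, s, rfl⟩ := PStalk.exists_germ a
  rfl

theorem isUnit_of_stalkMap_id {X : PresheafedSpace PRing.{u}} {f : X ⟶ X} (hf : f = 𝟙 X) (x : X)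
    {a : PStalk X.presheaf (f.base x)} (h : IsUnit (stalkMap f x a)) : IsUnit a := by
  subst hf
  have e : stalkMap (𝟙 X) x a = a := by
    obtain ⟨U, hU, s, rfl⟩ := PStalk.exists_germ a
    rfl
  rwa [e] at h

theorem isUnit_of_stalkMap_iso {X Y : PresheafedSpace PRing.{u}} (e : X ≅ Y) (x : X)
    {a : PStalk Y.presheaf (e.hom.base x)} (h : IsUnit (stalkMap e.hom x a)) : IsUnit a := by
  obtain ⟨y, rfl⟩ : ∃ y, e.inv.base y = x := ⟨e.hom.base x, by
    change (e.hom ≫ e.inv).base x = x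
    rw [e.hom_inv_id]
    rfl⟩
  refine isUnit_of_stalkMap_id e.inv_hom_id y ?_
  rw [stalkMap_comp]
  exact h.map (stalkMap e.inv y)

/-- The property that in each stalk the complement of the maximal ideal consists of units. The
usual argument that this is automatic needs the multiples of an element `a` to form an ideal, but
in a partial ring `a * x + a * y` may be defined when `x + y` is not. -/
def UnitStalks (X : LocallyPRingedSpace.{u}) : Prop :=
  ∀ (x : X.carrier) (a : PStalk X.presheaf x), a ∉ (X.isLocal x).maximalIdeal → IsUnit a

theorem isLocal_stalkMap_iso {X Y : LocallyPRingedSpace.{u}} (hX : X.UnitStalks)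
    (hY : Y.UnitStalks) (e : X.toPresheafedSpace ≅ Y.toPresheafedSpace) (x : X.carrier) :
    (stalkMap e.hom x).IsLocal (Y.isLocal (e.hom.base x)) (X.isLocal x) := by
  have key : ∀ {Z : LocallyPRingedSpace.{u}} {z : Z.carrier} {a : PStalk Z.presheaf z},
      IsUnit a → a ∉ (Z.isLocal z).maximalIdeal := by
    intro Z z a ha hm
    obtain ⟨b, hb⟩ := ha.exists_left_inv
    exact PIdeal.one_notMem (Z.isLocal z).isMaximal.ne_univ
      (hb ▸ ((Z.isLocal z).maximalIdeal).mul_mem b hm)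
  refine SetLike.ext fun a => ⟨fun h => ?_, fun h => ?_⟩
  · by_contra ha
    exact key ((hY _ a ha).map (stalkMap e.hom x)) h
  · by_contra ha
    exact key (isUnit_of_stalkMap_iso e x (hX x _ ha)) h

/-- An isomorphism of presheafed spaces gives an isomorphism of locally partial-ringed spaces
in whose stalks the complement of the maximal ideal consists of units. -/
def isoOfPresheafedSpaceIso {X Y : LocallyPRingedSpace.{u}} (hX : X.UnitStalks)
    (hY : Y.UnitStalks) (e : X.toPresheafedSpace ≅ Y.toPresheafedSpace) : X ≅ Y where
  hom := ⟨e.hom, isLocal_stalkMap_iso hX hY e⟩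
  inv := ⟨e.inv, isLocal_stalkMap_iso hY hX e.symm⟩
  hom_inv_id := Hom.ext e.hom_inv_id
  inv_hom_id := Hom.ext e.inv_hom_id

theorem unitStalks_Spec (A : PRing.{u}) : (Spec A).UnitStalks := by
  intro (p : TopCat.of (PSpec A)) a ha
  let f := (PSpec.toLocalization p).comp (PSheafify.stalkEval (PSpec.presheaf A) p)
  refine IsLocalPRing.isUnit_of_notMem _ (M := PIdeal.comap f (PSpec.locIdeal p)) ?_ ?_ ha
  · rw [PIdeal.mem_comap, map_one]
    exact PSpec.one_notMem_locIdeal p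
  · exact fun b hb => PSheafify.isUnit_of_stalkEval _ _ _ (PSpec.isUnit_of_notMem _ _ hb)

open PSpec in
/-- The isomorphism `Spec B ≅ Spec A` given by a homomorphism `A → B` which is an isomorphism
after localization at each prime ideal of `A`. -/
def specIso {A B : PRing.{u}} {ψ : PartialRingHom A B} (h : ψ.IsIsoAtPrimes) :
    Spec B ≅ Spec A :=
  isoOfPresheafedSpaceIso (unitStalks_Spec B) (unitStalks_Spec A) <|
    PresheafedSpace.isoOfComponents (X := (Spec B).toPresheafedSpace)
      (Y := (Spec A).toPresheafedSpace) (TopCat.isoOfHomeo (homeoComap h)) <|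
    Iso.symm <| NatIso.ofComponents
      (fun U => PRing.isoOfBijective (B := ⟨PSheafify.Sections (presheaf B) (preimage ψ U.unop)⟩)
        (sectionMap ψ U.unop) ⟨sectionMap_injective h, sectionMap_surjective h⟩
        (isSum_of_sectionMap h))
      (fun i => PartialRingHom.ext fun s => sectionMap_restrict i.unop.le s)

end LocallyPRingedSpace
end

theorem mainTheorem3 (A : PRing.{u}) :
    Nonempty (LocallyPRingedSpace.Spec A ≅
      LocallyPRingedSpace.Spec (LocallyPRingedSpace.Γ (LocallyPRingedSpace.Spec A))) := by
  exact ⟨(LocallyPRingedSpace.specIso (A := A)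
    (B := LocallyPRingedSpace.Γ (LocallyPRingedSpace.Spec A))
    (PSpec.isIsoAtPrimes_toGlobal (A := A))).symm⟩
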